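/- **Setting.** Let $L^2(\mathbb{R}^2)$ and $L^2(\mathbb{R}^2,\mathbb{C})$ denote the real-valued and the complex-valued square integrable functions on $\mathbb{R}^2$, let $\hat u$ be the Fourier transform of $u$ (normalized as $\hat u(x)=\int e^{-2\pi i\langle x,y\rangle}u(y)\,dy$, so that it is unitary on $L^2(\mathbb{R}^2,\mathbb{C})$ and $\widehat{k*u}=\hat k\,\hat u$), and put $\Delta(x)=1+|x|^2$, $\|u\|_{H^r}^2=\int_{\mathbb{R}^2}\Delta(x)^r|\hat u(x)|^2\,dx\in[0,\infty]$, $[w]_+=\max\{w,0\}$, and $\operatorname{sgn}(z)=z/|z|$ for $z\in\mathbb{C}\setminus\{0\}$, $\operatorname{sgn}(0)=0$. Norms $\|\cdot\|_{L^2}$ take the value $\infty$ on functions that are not square integrable, and pointwise relations between $L^2$ functions are understood for almost every $x\in\mathbb{R}^2$. **Lemma.** Let $f\in L^2(\mathbb{R}^2)$ be real-valued and band-limited (that is, $\hat f$ has compact support), let $r,s\ge 0$, and let $(\lambda_n)_{n\ge0}$, $(\mu_n)_{n\ge 0}$ be decreasing (not necessarily strictly) sequences of positive real numbers. (A) There are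 sequences $(U_n)_{n\ge 0}$, $(K_n)_{n\ge 0}$ of real-valued functions in $L^2(\mathbb{R}^2)$ with $$(U_0,K_0)\in\operatorname*{argmin}_{u,k\in L^2(\mathbb{R}^2)}\Big\{\|f-k*u\|_{L^2}^2+\lambda_0\|u\|_{H^r}^2+\mu_0\|k\|_{H^s}^2\Big\}$$ and, for all $n\ge 0$, $$(U_{n+1}-U_n,K_{n+1}-K_n)\in\operatorname*{argmin}_{u,k\in L^2(\mathbb{R}^2)}\Big\{\|f-(k+K_n)*(u+U_n)\|_{L^2}^2+\lambda_{n+1}\|u\|_{H^r}^2+\mu_{n+1}\|k\|_{H^s}^2\Big\},$$ such that $\hat K_n$ is real-valued and nonnegative for every $n\ge0$, and such that $P_n=\hat U_n$, $Q_n=\hat K_n$ satisfy the following rules. 1. $P_0=\operatorname{sgn}(\hat f)\sqrt{\Big[\sqrt{\tfrac{\mu_0}{\lambda_0}\Delta^{s-r}}\,|\hat f|-\mu_0\Delta^s\Big]_+}$ and $Q_0=\sqrt{\Big[\sqrt{\tfrac{\lambda_0}{\mu_0}\Delta^{r-s}}\,|\hat f|-\lambda_0\Delta^r\Big]_+}$.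 2. For every $n\ge 0$ the increments $\hat u_{n+1}=P_{n+1}-P_n$ and $\hat k_{n+1}=Q_{n+1}-Q_n$ satisfy $$(\hat u_{n+1},\hat k_{n+1})\in\operatorname*{argmin}_{p,q\in L^2(\mathbb{R}^2,\mathbb{C})}\Big\{\|\hat f-(p+P_n)(q+Q_n)\|_{L^2}^2+\lambda_{n+1}\int\Delta^r|p|^2+\mu_{n+1}\int\Delta^s|q|^2\Big\},$$ as well as $\hat k_{n+1}(x)\in[0,\infty)$, $\hat k_{n+1}(x)=\hat k_{n+1}(-x)$, $\hat u_{n+1}(x)=\overline{\hat u_{n+1}(-x)}$, and $$\operatorname{sgn}(\hat u_{n+1}(x))=\begin{cases}\operatorname{sgn}(\hat f(x)),&\text{if }|\hat f(x)|^2>\lambda_{n+1}\mu_{n+1}\Delta(x)^{r+s},\\0,&\text{otherwise.}\end{cases}$$ Moreover, $(\hat u_{n+1},\hat k_{n+1})$ can be taken to be a pointwise solution: for every $n\ge0$ and almost every $x$, the pair $(\hat u_{n+1}(x),\hat k_{n+1}(x))$ minimizes $$|\hat f(x)-(p+\hat U_n(x))(q+\hat K_n(x))|^2+\lambda_{n+1}\Delta(x)^r|p|^2+\mu_{n+1}\Delta(x)^s|q|^2$$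 over $p,q\in\mathbb{C}$ (so that, by the symmetries in rule 2, it suffices to solve this problem for $x$ in a half-plane). (B) Conversely, whenever sequences $(P_n)$, $(Q_n)$ in $L^2(\mathbb{R}^2,\mathbb{C})$ satisfy rules 1 and 2, the inverse Fourier transforms $U_n$ of $P_n$ and $K_n$ of $Q_n$ are real-valued, satisfy the two argmin conditions in (A), and have $\hat K_n=Q_n$ real-valued and nonnegative for all $n\ge0$. -/

import Mathlib

open MeasureTheory Set
open scoped FourierTransform ENNReal Convolution ComplexConjugate

noncomputable section

namespace BlindMHDM

/-- The plane `ℝ²` with its Euclidean norm. -/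
abbrev Plane : Type := EuclideanSpace ℝ (Fin 2)

/-- Real-valued square integrable functions on the plane. -/
abbrev L2R : Type := Lp (α := Plane) ℝ 2 volume

/-- Complex-valued square integrable functions on the plane. -/
abbrev L2C : Type := Lp (α := Plane) ℂ 2 volume

/-- The (unitary) Fourier transform of a real-valued `L²` function. The normalization is
`∫ e^{-2πi⟨x,ξ⟩} u(x) dx`, for which the Fourier transform of a convolution is the product of the
Fourier transforms without any constant. -/
def hat (u : L2R) : L2C := 𝓕 (Complex.ofRealCLM.compLp u : L2C)

/-- `Δ(x) = 1 + |x|²`. -/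
def Δ (x : Plane) : ℝ := 1 + ‖x‖ ^ 2

/-- `z / |z|` for `z ≠ 0`, and `0` for `z = 0`. -/
def sgn (z : ℂ) : ℂ := z / (‖z‖ : ℂ)

/-- `∫ Δ(x)^r |g(x)|² dx`, with value `∞` if the integral diverges. -/
def weightedSq (r : ℝ) (g : Plane → ℂ) : ℝ≥0∞ :=
  ∫⁻ x, ENNReal.ofReal (Δ x ^ r) * ‖g x‖ₑ ^ 2

/-- The squared Bessel potential norm `‖u‖²_{H^r}`, with value `∞` if `u ∉ H^r`. -/
def sobolevSq (r : ℝ) (u : L2R) : ℝ≥0∞ := weightedSq r (hat u)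

/-- The convolution `k * u` of two `L²` functions (a bounded continuous function, which need not
be square integrable). -/
def conv (k u : L2R) : Plane → ℝ :=
  (k : Plane → ℝ) ⋆[ContinuousLinearMap.mul ℝ ℝ, volume] (u : Plane → ℝ)

/-- `‖f - (k + K) * (u + U)‖²_{L²} + l ‖u‖²_{H^r} + m ‖k‖²_{H^s}`, with values in `[0, ∞]`. -/
def objective (f : L2R) (r s l m : ℝ) (U K u k : L2R) : ℝ≥0∞ :=
  eLpNorm (fun x => f x - conv (k + K) (u + U) x) 2 volume ^ 2
    + ENNReal.ofReal l * sobolevSq r u + ENNReal.ofReal m * sobolevSq s k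

/-- `(u, k)` minimizes the objective over all pairs of real-valued `L²` functions. -/
def IsStepMin (f : L2R) (r s l m : ℝ) (U K u k : L2R) : Prop :=
  ∀ v h : L2R, objective f r s l m U K u k ≤ objective f r s l m U K v h

/-- `(U, K)` is a sequence of iterates of the multiscale hierarchical decomposition method for
blind deconvolution of `f`, without constraint sets. -/
structure IsMHDM (f : L2R) (r s : ℝ) (lam mu : ℕ → ℝ) (U K : ℕ → L2R) : Prop where
  init : IsStepMin f r s (lam 0) (mu 0) 0 0 (U 0) (K 0)
  step : ∀ n, IsStepMin f r s (lam (n + 1)) (mu (n + 1)) (U n) (K n)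
    (U (n + 1) - U n) (K (n + 1) - K n)

/-- The Fourier transform of `f` vanishes outside a compact set. -/
def IsBandLimited (f : L2R) : Prop :=
  ∃ C : Set Plane, IsCompact C ∧ ∀ᵐ x, x ∉ C → hat f x = 0

/-- `g` is real-valued and nonnegative (almost everywhere). -/
def IsNonneg (g : L2C) : Prop := ∀ᵐ x, (g x).im = 0 ∧ 0 ≤ (g x).re

/-- The Fourier-side objective
`‖F - (p + P)(q + Q)‖²_{L²} + l ∫ Δ^r |p|² + m ∫ Δ^s |q|²`, with values in `[0, ∞]`. -/
def fourierObjective (F : L2C) (r s l m : ℝ) (P Q p q : L2C) : ℝ≥0∞ :=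
  eLpNorm (fun x => F x - (p x + P x) * (q x + Q x)) 2 volume ^ 2
    + ENNReal.ofReal l * weightedSq r p + ENNReal.ofReal m * weightedSq s q

/-- `(p, q)` minimizes the Fourier-side objective over all pairs of complex `L²` functions. -/
def IsFourierStepMin (F : L2C) (r s l m : ℝ) (P Q p q : L2C) : Prop :=
  ∀ v h : L2C, fourierObjective F r s l m P Q p q ≤ fourierObjective F r s l m P Q v h

/-- `|z - (p + p₀)(q + q₀)|² + a |p|² + b |q|²`. -/
def pointObjective (z p₀ q₀ : ℂ) (a b : ℝ) (p q : ℂ) : ℝ :=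
  ‖z - (p + p₀) * (q + q₀)‖ ^ 2 + a * ‖p‖ ^ 2 + b * ‖q‖ ^ 2

/-- The Fourier-side increments `(p n, q n) = (P (n+1) - P n, Q (n+1) - Q n)` solve at almost every
frequency the pointwise minimization problem over `ℂ × ℂ`. -/
def IsPointwiseMin (F : L2C) (r s : ℝ) (lam mu : ℕ → ℝ) (P Q : ℕ → L2C) : Prop :=
  ∀ n, ∀ᵐ x, ∀ v h : ℂ,
    pointObjective (F x) (P n x) (Q n x) (lam (n + 1) * Δ x ^ r) (mu (n + 1) * Δ x ^ s)
        ((P (n + 1) - P n) x) ((Q (n + 1) - Q n) x)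
      ≤ pointObjective (F x) (P n x) (Q n x) (lam (n + 1) * Δ x ^ r) (mu (n + 1) * Δ x ^ s) v h

/-- The recipe in Fourier space, for the datum `F = f̂` and the iterates `(P n, Q n) = (Û_n, K̂_n)`:
the formulas for the first iterates, and the requirements on the increments
`û_{n+1} = P (n + 1) - P n` and `k̂_{n+1} = Q (n + 1) - Q n`. -/
structure IsFourierRecipe (F : L2C) (r s : ℝ) (lam mu : ℕ → ℝ) (P Q : ℕ → L2C) : Prop where
  init_image : ∀ᵐ x, P 0 x = sgn (F x) *
    (√(max (√(mu 0 / lam 0 * Δ x ^ (s - r)) * ‖F x‖ - mu 0 * Δ x ^ s) 0) : ℝ)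
  init_kernel : ∀ᵐ x, Q 0 x =
    (√(max (√(lam 0 / mu 0 * Δ x ^ (r - s)) * ‖F x‖ - lam 0 * Δ x ^ r) 0) : ℝ)
  step_min : ∀ n, IsFourierStepMin F r s (lam (n + 1)) (mu (n + 1)) (P n) (Q n)
    (P (n + 1) - P n) (Q (n + 1) - Q n)
  kernel_nonneg : ∀ n, IsNonneg (Q (n + 1) - Q n)
  kernel_symm : ∀ n, ∀ᵐ x, (Q (n + 1) - Q n) x = (Q (n + 1) - Q n) (-x)
  image_symm : ∀ n, ∀ᵐ x, (P (n + 1) - P n) x = conj ((P (n + 1) - P n) (-x))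
  /-- The image increment has the phase of `F` at the frequencies that are not thresholded at
  this step, and vanishes at the others. -/
  image_sgn : ∀ n, ∀ᵐ x,
    (lam (n + 1) * mu (n + 1) * Δ x ^ (r + s) < ‖F x‖ ^ 2 →
      sgn ((P (n + 1) - P n) x) = sgn (F x)) ∧
    (‖F x‖ ^ 2 ≤ lam (n + 1) * mu (n + 1) * Δ x ^ (r + s) → (P (n + 1) - P n) x = 0)

end BlindMHDM

end

/-!
By Plancherel, both minimization problems become integrals over the frequencies `x` of
`pointObjective`, so it suffices to minimize over `p, q ∈ ℂ` at each frequency. There the iterates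
can be sought with the phase of `f̂ x` in the image and with nonnegative moduli: for `z ≥ p₀ * q₀`,
increments whose moduli overshoot `z` may be scaled down to fit `z` exactly, and otherwise the
triangle inequality shows that replacing increments by their moduli does not increase the objective.
The bound `p₀ * q₀ ≤ z` is preserved by the iteration, because at a minimizer the residual
`z - (p + p₀) * (q + q₀)` is, by the critical point equations, a nonnegative number.

The first step is explicit: by the inequality of arithmetic and geometric means, the product of the
moduli solves a soft thresholding problem with threshold `√(a * b)`. In the later steps, minimizing
over the kernel in closed form leaves a continuous coercive function of the image modulus, whose
least minimizer depends measurably on `x`. A minimizer is at least as good as the zero increment,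
which bounds its square by `‖f̂ x‖ ^ 2` over the weight and puts the iterates into `L²`. Everything
depends on `x` only through `f̂ x` and `Δ x`, so the Hermitian symmetry of `f̂` passes to the
iterates, and their inverse Fourier transforms are real-valued.
-/

noncomputable section

namespace BlindMHDM

open Filter SchwartzMap
open scoped NNReal Topology

section ConjSub

variable {V : Type*} [NormedAddCommGroup V] [NormedSpace ℝ V]

/-- The Schwartz function `x ↦ conj (φ (a - x))`. -/
def conjSub (a : V) (φ : 𝓢(V, ℂ)) : 𝓢(V, ℂ) :=
  (compCLMOfContinuousLinearEquiv ℝ (ContinuousLinearEquiv.neg ℝ)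
    (φ.postcompCLM (Complex.conjCLE : ℂ →L[ℝ] ℂ))).compSubConstCLM ℝ a

lemma conjSub_apply (a : V) (φ : 𝓢(V, ℂ)) (x : V) : conjSub a φ x = conj (φ (a - x)) := by
  change conj (φ (-(x - a))) = _
  rw [neg_sub]

end ConjSub

section Fourier

variable {E : Type*} [NormedAddCommGroup E] [InnerProductSpace ℝ E] [FiniteDimensional ℝ E]
  [MeasurableSpace E] [BorelSpace E]

/-- Complex-valued square integrable functions on `E`, with respect to Lebesgue measure. -/
abbrev ComplexL2 (E : Type*) [NormedAddCommGroup E] [InnerProductSpace ℝ E]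
    [FiniteDimensional ℝ E] [MeasurableSpace E] [BorelSpace E] : Type _ :=
  Lp (α := E) ℂ 2 volume

lemma ae_eq_of_integral_schwartz_mul_eq {g h : E → ℂ} (hg : LocallyIntegrable g)
    (hh : LocallyIntegrable h) (hgh : ∀ φ : 𝓢(E, ℂ), ∫ x, φ x * g x = ∫ x, φ x * h x) :
    g =ᵐ[volume] h := by
  refine ae_eq_of_integral_contDiff_smul_eq hg hh fun η η_smooth η_supp => ?_
  have hη_supp : HasCompactSupport (Complex.ofRealCLM ∘ η) := η_supp.comp_left rfl
  have hη_smooth : ContDiff ℝ (⊤ : ℕ∞) (Complex.ofRealCLM ∘ η) := by fun_prop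
  simpa using hgh (hη_supp.toSchwartzMap hη_smooth)

lemma locallyIntegrable_coe (g : ComplexL2 E) : LocallyIntegrable g :=
  (Lp.memLp g).locallyIntegrable (by norm_num)

lemma memLp_comp_sub_left {h : E → ℂ} (hh : MemLp h 2) (a : E) : MemLp (fun x => h (a - x)) 2 :=
  hh.comp_measurePreserving (Measure.measurePreserving_sub_left volume a)

/-- `h` is the Fourier transform of `g` in the sense of tempered distributions. Unlike `𝓕` on `L²`,
this makes sense for functions that need not be square integrable. -/
def IsFourierPair (g h : E → ℂ) : Prop :=
  ∀ φ : 𝓢(E, ℂ), ∫ x, φ x * h x = ∫ x, 𝓕 φ x * g x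

lemma isFourierPair_fourier (g : ComplexL2 E) : IsFourierPair g (𝓕 g : ComplexL2 E) := by
  intro φ
  have h := congrArg (fun T : 𝓢'(E, ℂ) => T φ) (Lp.fourier_toTemperedDistribution_eq g)
  simpa [Lp.toTemperedDistribution_apply] using h.symm

lemma isFourierPair_fourierInv {w : E → ℂ} (hw : Integrable w) : IsFourierPair (𝓕⁻ w) w := by
  intro φ
  have h := VectorFourier.integral_fourierIntegral_smul_eq_flip (μ := volume) (ν := volume)
    (L := -innerₗ E) (f := w) (g := (𝓕 φ : 𝓢(E, ℂ))) Real.continuous_fourierChar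
    (by simpa using! continuous_inner.neg) hw (𝓕 φ).integrable
  have h_inv : VectorFourier.fourierIntegral Real.fourierChar volume (-innerₗ E).flip
      (𝓕 φ : 𝓢(E, ℂ)) = φ := by
    rw [show (-innerₗ E).flip = -innerₗ E by ext x y; simp [real_inner_comm]]
    change 𝓕⁻ ((𝓕 φ : 𝓢(E, ℂ)) : E → ℂ) = φ
    rw [← fourierInv_coe, FourierTransform.fourierInv_fourier_eq]
  rw [h_inv] at h
  simp only [smul_eq_mul] at h
  simp only [mul_comm (φ _), mul_comm (𝓕 φ _)]
  exact h.symm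

namespace IsFourierPair

lemma congr {g g' h h' : E → ℂ} (H : IsFourierPair g h) (hg : g =ᵐ[volume] g')
    (hh : h =ᵐ[volume] h') : IsFourierPair g' h' := fun φ => calc
  ∫ x, φ x * h' x = ∫ x, φ x * h x := integral_congr_ae (hh.symm.mono fun x hx => by simp only [hx])
  _ = ∫ x, 𝓕 φ x * g x := H φ
  _ = ∫ x, 𝓕 φ x * g' x := integral_congr_ae (hg.mono fun x hx => by simp only [hx])

lemma sub {g₁ g₂ h₁ h₂ : E → ℂ} (H₁ : IsFourierPair g₁ h₁) (H₂ : IsFourierPair g₂ h₂)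
    (hg₁ : ∀ φ : 𝓢(E, ℂ), Integrable fun x => φ x * g₁ x)
    (hg₂ : ∀ φ : 𝓢(E, ℂ), Integrable fun x => φ x * g₂ x)
    (hh₁ : ∀ φ : 𝓢(E, ℂ), Integrable fun x => φ x * h₁ x)
    (hh₂ : ∀ φ : 𝓢(E, ℂ), Integrable fun x => φ x * h₂ x) :
    IsFourierPair (g₁ - g₂) (h₁ - h₂) := by
  intro φ
  simp only [Pi.sub_apply, mul_sub]
  rw [integral_sub (hh₁ φ) (hh₂ φ), integral_sub (hg₁ _) (hg₂ _), H₁, H₂]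

lemma fourier_ae_eq {g : ComplexL2 E} {h : E → ℂ} (H : IsFourierPair g h)
    (hh : LocallyIntegrable h) : (𝓕 g : ComplexL2 E) =ᵐ[volume] h :=
  ae_eq_of_integral_schwartz_mul_eq (locallyIntegrable_coe _) hh fun φ => by
    rw [H φ, isFourierPair_fourier g φ]

lemma fourierInv_ae_eq {g : E → ℂ} {h : ComplexL2 E} (H : IsFourierPair g h)
    (hg : LocallyIntegrable g) : (𝓕⁻ h : ComplexL2 E) =ᵐ[volume] g :=
  ae_eq_of_integral_schwartz_mul_eq (locallyIntegrable_coe _) hg fun φ => by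
    have h_inv := isFourierPair_fourier (𝓕⁻ h : ComplexL2 E) (𝓕⁻ φ)
    have h_pair := H (𝓕⁻ φ)
    simp only [FourierTransform.fourier_fourierInv_eq] at h_inv h_pair
    rw [← h_inv, h_pair]

lemma eLpNorm_eq_of_memLp_left {g h : E → ℂ} (H : IsFourierPair g h) (hg : MemLp g 2)
    (hh : LocallyIntegrable h) : eLpNorm h 2 = eLpNorm g 2 := by
  have h_ae : (𝓕 (hg.toLp g) : ComplexL2 E) =ᵐ[volume] h :=
    (H.congr hg.coeFn_toLp.symm (ae_eq_refl _)).fourier_ae_eq hh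
  rw [← eLpNorm_congr_ae h_ae, ← eLpNorm_congr_ae hg.coeFn_toLp, ← Lp.enorm_def, ← Lp.enorm_def,
    ← ofReal_norm, ← ofReal_norm, Lp.norm_fourier_eq]

lemma memLp_left {g h : E → ℂ} (H : IsFourierPair g h) (hg : LocallyIntegrable g)
    (hh : MemLp h 2) : MemLp g 2 :=
  (Lp.memLp (𝓕⁻ (hh.toLp h) : ComplexL2 E)).ae_eq <|
    (H.congr (ae_eq_refl _) hh.coeFn_toLp.symm).fourierInv_ae_eq hg

/-- Plancherel's identity, including the case where both sides are infinite. -/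
lemma eLpNorm_eq {g h : E → ℂ} (H : IsFourierPair g h) (hg : LocallyIntegrable g)
    (hh : LocallyIntegrable h) : eLpNorm h 2 = eLpNorm g 2 := by
  by_cases hg2 : MemLp g 2
  · exact H.eLpNorm_eq_of_memLp_left hg2 hh
  · have hh2 : ¬ MemLp h 2 := fun hh2 => hg2 (H.memLp_left hg hh2)
    have h_top {w : E → ℂ} (hw : LocallyIntegrable w) (hw2 : ¬ MemLp w 2) : eLpNorm w 2 = ∞ := by
      contrapose! hw2
      exact ⟨hw.aestronglyMeasurable, hw2.lt_top⟩
    rw [h_top hg hg2, h_top hh hh2]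

end IsFourierPair

lemma continuous_fourierInv {w : E → ℂ} (hw : Integrable w) : Continuous (𝓕⁻ w) :=
  VectorFourier.fourierIntegral_continuous Real.continuous_fourierChar
    (by simpa using! continuous_inner.neg) hw

lemma eLpNorm_fourier_sub (f : ComplexL2 E) {w : E → ℂ} (hw : Integrable w) :
    eLpNorm (⇑(𝓕 f : ComplexL2 E) - w) 2 = eLpNorm (⇑f - 𝓕⁻ w) 2 := by
  have h_bound (x : E) : ‖𝓕⁻ w x‖ ≤ ∫ y, ‖w y‖ :=
    VectorFourier.norm_fourierIntegral_le_integral_norm _ _ _ _ _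
  have h_L2 (g : ComplexL2 E) (φ : 𝓢(E, ℂ)) : Integrable fun x => φ x * g x :=
    (φ.memLp 2 volume).integrable_mul (Lp.memLp g)
  have h_pair : IsFourierPair (⇑f - 𝓕⁻ w) (⇑(𝓕 f : ComplexL2 E) - w) :=
    (isFourierPair_fourier f).sub (isFourierPair_fourierInv hw) (h_L2 f)
      (fun φ => φ.integrable.mul_bdd (continuous_fourierInv hw).aestronglyMeasurable
        (.of_forall h_bound))
      (h_L2 _)
      (fun φ => hw.bdd_mul φ.continuous.aestronglyMeasurable
        (.of_forall φ.toBoundedContinuousFunction.norm_coe_le_norm))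
  exact h_pair.eLpNorm_eq
    ((locallyIntegrable_coe f).sub (continuous_fourierInv hw).locallyIntegrable)
    ((locallyIntegrable_coe _).sub hw.locallyIntegrable)

lemma fourier_conj_comp_sub_left (g : E → ℂ) (a ξ : E) :
    𝓕 (fun x => conj (g (a - x))) ξ = conj (Real.fourierChar (inner ℝ a ξ) * 𝓕 g ξ) := by
  rw [Real.fourier_eq, Real.fourier_eq, ← integral_sub_left_eq_self _ volume a,
    ← integral_const_mul, ← integral_conj]
  refine integral_congr_ae (.of_forall fun v => ?_)
  simp [Circle.smul_def, inner_sub_left, AddChar.map_sub_eq_div, AddChar.map_neg_eq_inv]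
  ring

lemma fourier_conjSub_zero (φ : 𝓢(E, ℂ)) (ξ : E) : 𝓕 (conjSub 0 φ) ξ = conj (𝓕 φ ξ) := by
  have h := fourier_conj_comp_sub_left φ 0 ξ
  simp only [← conjSub_apply, inner_zero_left, AddChar.map_zero_eq_one, Circle.coe_one,
    one_mul] at h
  exact h

lemma fourierInv_conjSub (a : E) (φ : 𝓢(E, ℂ)) (ξ : E) :
    𝓕⁻ (conjSub a φ) ξ = Real.fourierChar (inner ℝ a ξ) * conj (𝓕⁻ φ ξ) := by
  rw [fourierInv_coe, fourierInv_coe, Real.fourierInv_eq_fourier_neg,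
    Real.fourierInv_eq_fourier_neg]
  have h := fourier_conj_comp_sub_left φ a (-ξ)
  simp only [← conjSub_apply, inner_neg_right, AddChar.map_neg_eq_inv, map_mul,
    Circle.coe_inv_eq_conj, Complex.conj_conj] at h
  exact h

lemma isFourierPair_conj (g : ComplexL2 E) :
    IsFourierPair (fun x => conj (g x)) (fun ξ => conj ((𝓕 g : ComplexL2 E) (-ξ))) := by
  intro φ
  have h := congrArg conj (isFourierPair_fourier g (conjSub 0 φ))
  rw [← integral_conj, ← integral_conj, ← integral_neg_eq_self] at h
  simpa [conjSub_apply, fourier_conjSub_zero] using h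

lemma isFourierPair_conj_comp_sub_left (a : E) (g : ComplexL2 E) :
    IsFourierPair (fun x => conj (g (a - x)))
      (fun ξ => conj (Real.fourierChar (inner ℝ a ξ) * (𝓕 g : ComplexL2 E) ξ)) := by
  intro φ
  have h := congrArg conj (isFourierPair_fourier g (𝓕⁻ (conjSub a (𝓕 φ))))
  rw [FourierTransform.fourier_fourierInv_eq, ← integral_conj, ← integral_conj,
    ← integral_sub_left_eq_self (fun x => conj (conjSub a (𝓕 φ) x * g x)) volume a] at h
  simp only [conjSub_apply, fourierInv_conjSub, FourierTransform.fourierInv_fourier_eq,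
    sub_sub_cancel, map_mul, Complex.conj_conj] at h
  rw [← h]
  exact integral_congr_ae (.of_forall fun ξ => by simp only [map_mul]; ring)

lemma fourier_star_ae_eq (g : ComplexL2 E) :
    (𝓕 (star g) : ComplexL2 E) =ᵐ[volume] fun ξ => conj ((𝓕 g : ComplexL2 E) (-ξ)) := by
  have h_memLp : MemLp (fun ξ => conj ((𝓕 g : ComplexL2 E) (-ξ))) 2 := by
    simpa using! (memLp_comp_sub_left (Lp.memLp (𝓕 g : ComplexL2 E)) 0).star
  exact ((isFourierPair_conj g).congr (Lp.coeFn_star g).symm (ae_eq_refl _)).fourier_ae_eq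
    (h_memLp.locallyIntegrable (by norm_num))

lemma fourier_conj_comp_sub_left_ae_eq (a : E) {g v : ComplexL2 E}
    (hv : v =ᵐ[volume] fun x => conj (g (a - x))) :
    (𝓕 v : ComplexL2 E) =ᵐ[volume] fun ξ => conj (Real.fourierChar (inner ℝ a ξ) *
      (𝓕 g : ComplexL2 E) ξ) := by
  have h_char : Continuous fun ξ : E => (Real.fourierChar (inner ℝ a ξ) : ℂ) :=
    by fun_prop
  have h_memLp : MemLp (fun ξ => conj (Real.fourierChar (inner ℝ a ξ) *
      (𝓕 g : ComplexL2 E) ξ)) 2 := by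
    refine ((Lp.memLp (𝓕 g : ComplexL2 E)).of_le
      (h_char.aestronglyMeasurable.mul (Lp.memLp _).aestronglyMeasurable) ?_).star
    exact .of_forall fun ξ => by rw [Pi.mul_apply, norm_mul, Circle.norm_coe, one_mul]
  exact ((isFourierPair_conj_comp_sub_left a g).congr hv.symm (ae_eq_refl _)).fourier_ae_eq
    (h_memLp.locallyIntegrable (by norm_num))

/-- Parseval's identity turns `(g ⋆ h) a`, the inner product of `x ↦ conj (h (a - x))` and `g`,
into the inner product of their Fourier transforms. -/
theorem convolution_eq_fourierInv_mul (g h : ComplexL2 E) (a : E) :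
    ((g : E → ℂ) ⋆[ContinuousLinearMap.mul ℂ ℂ] (h : E → ℂ)) a =
      𝓕⁻ (fun ξ => (𝓕 g : ComplexL2 E) ξ * (𝓕 h : ComplexL2 E) ξ) a := by
  have hm : MemLp (fun x => conj (h (a - x))) 2 := (memLp_comp_sub_left (Lp.memLp h) a).star
  calc ((g : E → ℂ) ⋆[ContinuousLinearMap.mul ℂ ℂ] (h : E → ℂ)) a
      = ∫ x, inner ℂ (hm.toLp _ x) (g x) := by
        rw [convolution_def]
        refine integral_congr_ae (hm.coeFn_toLp.mono fun x hx => ?_)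
        simp [hx]
    _ = ∫ ξ, inner ℂ ((𝓕 (hm.toLp _) : ComplexL2 E) ξ) ((𝓕 g : ComplexL2 E) ξ) := by
        rw [← L2.inner_def, ← L2.inner_def, Lp.inner_fourier_eq]
    _ = 𝓕⁻ (fun ξ => (𝓕 g : ComplexL2 E) ξ * (𝓕 h : ComplexL2 E) ξ) a := by
        rw [Real.fourierInv_eq]
        refine integral_congr_ae
          ((fourier_conj_comp_sub_left_ae_eq a hm.coeFn_toLp).mono fun ξ hξ => ?_)
        simp [hξ, Circle.smul_def, real_inner_comm]
        ring

end Fourier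

section Hat

/-- The complexification of a real-valued square integrable function. -/
def complexify (u : L2R) : L2C := Complex.ofRealCLM.compLp u

/-- The symmetry that characterizes the Fourier transforms of real-valued functions. -/
def IsHermitian (g : L2C) : Prop := ∀ᵐ x, g x = conj (g (-x))

lemma complexify_ae_eq (u : L2R) : complexify u =ᵐ[volume] fun x => (u x : ℂ) :=
  Complex.ofRealCLM.coeFn_compLp u

lemma star_complexify (u : L2R) : star (complexify u) = complexify u := by
  refine Lp.ext ((Lp.coeFn_star _).trans ?_)
  filter_upwards [complexify_ae_eq u] with x hx
  simp [hx]

lemma exists_complexify_eq {g : L2C} (hg : star g = g) : ∃ u, complexify u = g := by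
  refine ⟨Complex.reCLM.compLp g, Lp.ext ?_⟩
  filter_upwards [complexify_ae_eq (Complex.reCLM.compLp g), Complex.reCLM.coeFn_compLp g,
    Lp.coeFn_star g] with x h_complexify h_re h_star
  rw [hg] at h_star
  rw [h_complexify, h_re]
  exact Complex.conj_eq_iff_re.1 h_star.symm

lemma isHermitian_hat (u : L2R) : IsHermitian (hat u) := by
  have h := fourier_star_ae_eq (complexify u)
  rwa [star_complexify] at h

lemma exists_hat_eq {P : L2C} (hP : IsHermitian P) : ∃ u, hat u = P := by
  have h_fourier : 𝓕 (𝓕⁻ P : L2C) = P := FourierTransform.fourier_fourierInv_eq P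
  have h_star : star (𝓕⁻ P : L2C) = 𝓕⁻ P := by
    refine (Lp.fourierTransformₗᵢ Plane ℂ).injective (Lp.ext ?_)
    change (𝓕 (star (𝓕⁻ P : L2C)) : L2C) =ᵐ[volume] (𝓕 (𝓕⁻ P : L2C) : L2C)
    have h := fourier_star_ae_eq (𝓕⁻ P : L2C)
    rw [h_fourier] at h ⊢
    exact h.trans (hP.mono fun x hx => hx.symm)
  obtain ⟨u, hu⟩ := exists_complexify_eq h_star
  exact ⟨u, (congrArg (fun g : L2C => 𝓕 g) hu).trans h_fourier⟩

lemma hat_add (u v : L2R) : hat (u + v) = hat u + hat v :=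
  (congrArg (Lp.fourierTransformₗᵢ Plane ℂ)
    (map_add (Complex.ofRealCLM.compLpL 2 volume) u v)).trans (map_add _ _ _)

lemma hat_sub (u v : L2R) : hat (u - v) = hat u - hat v :=
  (congrArg (Lp.fourierTransformₗᵢ Plane ℂ)
    (map_sub (Complex.ofRealCLM.compLpL 2 volume) u v)).trans (map_sub _ _ _)

lemma hat_zero : hat 0 = 0 := by simpa using hat_sub 0 0

lemma conv_eq_fourierInv (k u : L2R) (x : Plane) :
    (conv k u x : ℂ) = 𝓕⁻ (fun ξ => hat k ξ * hat u ξ) x := by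
  refine Eq.trans ?_ (convolution_eq_fourierInv_mul (complexify k) (complexify u) x)
  rw [conv, convolution_def, convolution_def, ← integral_complex_ofReal]
  have hu : ∀ᵐ y, complexify u (x - y) = (u (x - y) : ℂ) :=
    (Measure.measurePreserving_sub_left volume x).quasiMeasurePreserving.ae (complexify_ae_eq u)
  refine integral_congr_ae ?_
  filter_upwards [complexify_ae_eq k, hu] with y hk hu
  simp [hk, hu]

lemma eLpNorm_sub_conv (f k u : L2R) :
    eLpNorm (fun x => f x - conv k u x) 2 volume =
      eLpNorm (fun x => hat f x - hat u x * hat k x) 2 volume := by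
  have h := eLpNorm_fourier_sub (complexify f)
    ((Lp.memLp (hat k)).integrable_mul (Lp.memLp (hat u)))
  calc eLpNorm (fun x => f x - conv k u x) 2 volume
      = eLpNorm (⇑(complexify f) - 𝓕⁻ (hat k * hat u : Plane → ℂ)) 2 volume := by
        refine eLpNorm_congr_norm_ae ((complexify_ae_eq f).mono fun x hx => ?_)
        rw [Pi.sub_apply, hx, ← Complex.norm_real, Complex.ofReal_sub, conv_eq_fourierInv]
        rfl
    _ = eLpNorm (⇑(hat f) - (hat k * hat u : Plane → ℂ)) 2 volume := h.symm
    _ = eLpNorm (fun x => hat f x - hat u x * hat k x) 2 volume := by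
        simp only [mul_comm (hat u _)]
        rfl

lemma objective_eq_fourierObjective (f : L2R) (r s l m : ℝ) (U K u k : L2R) :
    objective f r s l m U K u k =
      fourierObjective (hat f) r s l m (hat U) (hat K) (hat u) (hat k) := by
  rw [objective, fourierObjective, eLpNorm_sub_conv, hat_add, hat_add, sobolevSq, sobolevSq]
  congr 3
  refine eLpNorm_congr_ae ?_
  filter_upwards [Lp.coeFn_add (hat u) (hat U), Lp.coeFn_add (hat k) (hat K)] with x hu hk
  rw [hu, hk, Pi.add_apply, Pi.add_apply]

lemma IsFourierStepMin.isStepMin {f : L2R} {r s l m : ℝ} {U K u k : L2R}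
    (h : IsFourierStepMin (hat f) r s l m (hat U) (hat K) (hat u) (hat k)) :
    IsStepMin f r s l m U K u k := fun v w => by
  simpa only [objective_eq_fourierObjective] using h (hat v) (hat w)

end Hat

section LeastArgmin

lemma measurable_iInf_of_continuous {X Y : Type*} [MeasurableSpace X] [TopologicalSpace Y]
    [SecondCountableTopology Y] {G : X → Y → ℝ} (hm : ∀ y, Measurable fun x => G x y)
    (hc : ∀ x, Continuous (G x)) : Measurable fun x => ⨅ y, G x y := by
  obtain ⟨D, hD_countable, hD_dense⟩ := TopologicalSpace.exists_countable_dense Y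
  have := hD_countable.to_subtype
  simp only [← hD_dense.ciInf' (hc _)]
  exact Measurable.iInf fun y => hm y

variable {α : Type*} [ConditionallyCompleteLinearOrderBot α]

/-- The least minimizer of `g`, a choice of minimizer that depends measurably on parameters
(`measurable_leastArgmin`). It is junk if `g` has no least minimizer. -/
def leastArgmin (g : α → ℝ) : α := sInf {p | ∀ p', g p ≤ g p'}

variable [TopologicalSpace α] [OrderTopology α]

lemma apply_leastArgmin_le {g : α → ℝ} (hg : Continuous g) (hne : ∃ p, ∀ p', g p ≤ g p')
    (p' : α) : g (leastArgmin g) ≤ g p' := by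
  have h_closed : IsClosed {p | ∀ p', g p ≤ g p'} := by
    simp only [ofPred_forall]
    exact isClosed_iInter fun p' => isClosed_le hg continuous_const
  exact h_closed.csInf_mem hne (OrderBot.bddBelow _) p'

lemma leastArgmin_le_iff {g : α → ℝ} (hg : Continuous g) (hne : ∃ p, ∀ p', g p ≤ g p') (t : α) :
    leastArgmin g ≤ t ↔ ⨅ p, g (min p t) ≤ ⨅ p, g p := by
  have hmin := apply_leastArgmin_le hg hne
  have h_bdd : BddBelow (range fun p => g (min p t)) :=
    ⟨g (leastArgmin g), forall_mem_range.2 fun p => hmin _⟩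
  constructor
  · intro hle
    calc ⨅ p, g (min p t) ≤ g (min (leastArgmin g) t) := ciInf_le h_bdd _
      _ = g (leastArgmin g) := by rw [min_eq_left hle]
      _ ≤ ⨅ p, g p := le_ciInf hmin
  · intro hle
    obtain ⟨p, hp, hp_min⟩ := (isCompact_Icc (a := ⊥) (b := t)).exists_isMinOn
      ⟨⊥, le_rfl, bot_le⟩ hg.continuousOn
    refine (csInf_le (OrderBot.bddBelow _) fun p' => ?_).trans hp.2
    calc g p ≤ ⨅ p, g (min p t) :=
          le_ciInf fun p' => isMinOn_iff.1 hp_min _ ⟨bot_le, min_le_right _ _⟩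
      _ ≤ ⨅ p, g p := hle
      _ ≤ g p' := ciInf_le ⟨g (leastArgmin g), forall_mem_range.2 hmin⟩ p'

lemma measurable_leastArgmin [SecondCountableTopology α] [MeasurableSpace α] [BorelSpace α]
    {X : Type*} [MeasurableSpace X] {G : X → α → ℝ} (hm : ∀ p, Measurable fun x => G x p)
    (hc : ∀ x, Continuous (G x)) (hne : ∀ x, ∃ p, ∀ p', G x p ≤ G x p') :
    Measurable fun x => leastArgmin (G x) := by
  refine measurable_of_Iic fun t => ?_
  simp only [preimage, mem_Iic, leastArgmin_le_iff (hc _) (hne _)]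
  exact measurableSet_le
    (measurable_iInf_of_continuous (fun p => hm _) fun x => (hc x).comp (by fun_prop))
    (measurable_iInf_of_continuous hm hc)

end LeastArgmin

section Pointwise

/-- `(p, q)` minimizes the pointwise objective over all pairs of complex increments. -/
def IsPointMin (z p₀ q₀ : ℂ) (a b : ℝ) (p q : ℂ) : Prop :=
  ∀ v w : ℂ, pointObjective z p₀ q₀ a b p q ≤ pointObjective z p₀ q₀ a b v w

/-- The pointwise objective for real data and real increments. -/
def realObjective (z p₀ q₀ a b p q : ℝ) : ℝ :=
  (z - (p + p₀) * (q + q₀)) ^ 2 + a * p ^ 2 + b * q ^ 2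

/-- `(p, q)` minimizes the pointwise objective over all pairs of real increments. -/
def IsRealMin (z p₀ q₀ a b p q : ℝ) : Prop :=
  ∀ v w : ℝ, realObjective z p₀ q₀ a b p q ≤ realObjective z p₀ q₀ a b v w

variable {z p₀ q₀ a b p q : ℝ}

lemma pointObjective_ofReal (z p₀ q₀ a b p q : ℝ) :
    pointObjective z p₀ q₀ a b p q = realObjective z p₀ q₀ a b p q := by
  simp only [pointObjective, realObjective, ← Complex.ofReal_add, ← Complex.ofReal_mul,
    ← Complex.ofReal_sub, Complex.norm_real, Real.norm_eq_abs, sq_abs]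

lemma IsPointMin.isRealMin (h : IsPointMin z p₀ q₀ a b p q) : IsRealMin z p₀ q₀ a b p q :=
  fun v w => by simpa only [pointObjective_ofReal] using h v w

lemma realObjective_swap (z p₀ q₀ a b p q : ℝ) :
    realObjective z q₀ p₀ b a q p = realObjective z p₀ q₀ a b p q := by
  unfold realObjective
  ring

lemma realObjective_norm_le_pointObjective {v w : ℂ} (hp₀ : 0 ≤ p₀) (hq₀ : 0 ≤ q₀)
    (h : (‖v‖ + p₀) * (‖w‖ + q₀) ≤ z) :
    realObjective z p₀ q₀ a b ‖v‖ ‖w‖ ≤ pointObjective z p₀ q₀ a b v w := by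
  have h_norm_add (u : ℂ) {t : ℝ} (ht : 0 ≤ t) : ‖u + t‖ ≤ ‖u‖ + t :=
    (norm_add_le _ _).trans_eq (by rw [Complex.norm_of_nonneg ht])
  have h_residual : z - (‖v‖ + p₀) * (‖w‖ + q₀) ≤ ‖(z : ℂ) - (v + p₀) * (w + q₀)‖ := calc
    z - (‖v‖ + p₀) * (‖w‖ + q₀) ≤ ‖(z : ℂ)‖ - ‖(v + p₀) * (w + q₀)‖ := by
      rw [norm_mul, Complex.norm_real]
      gcongr
      exacts [le_abs_self z, h_norm_add v hp₀, h_norm_add w hq₀]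
    _ ≤ _ := norm_sub_norm_le _ _
  have h_sq := pow_le_pow_left₀ (sub_nonneg.2 h) h_residual 2
  unfold realObjective pointObjective
  linarith

/-- If the moduli of the increments overshoot the data, then scaling them down to fit the data
exactly decreases the objective. -/
lemma exists_realObjective_le_pointObjective (hp₀ : 0 ≤ p₀) (hq₀ : 0 ≤ q₀) (ha : 0 ≤ a)
    (hb : 0 ≤ b) (hz : p₀ * q₀ ≤ z) (v w : ℂ) :
    ∃ p q : ℝ, 0 ≤ p ∧ 0 ≤ q ∧
      realObjective z p₀ q₀ a b p q ≤ pointObjective z p₀ q₀ a b v w := by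
  rcases le_total ((‖v‖ + p₀) * (‖w‖ + q₀)) z with hle | hle
  · exact ⟨‖v‖, ‖w‖, norm_nonneg _, norm_nonneg _, realObjective_norm_le_pointObjective hp₀ hq₀ hle⟩
  obtain ⟨t, ⟨ht₀, ht₁⟩, ht : (t * ‖v‖ + p₀) * (t * ‖w‖ + q₀) = z⟩ :=
    intermediate_value_Icc (zero_le_one' ℝ)
      (f := fun t : ℝ => (t * ‖v‖ + p₀) * (t * ‖w‖ + q₀)) (by fun_prop)
      (show z ∈ Icc _ _ by simpa using ⟨hz, hle⟩)
  refine ⟨t * ‖v‖, t * ‖w‖, by positivity, by positivity, ?_⟩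
  calc realObjective z p₀ q₀ a b (t * ‖v‖) (t * ‖w‖)
      = a * (t * ‖v‖) ^ 2 + b * (t * ‖w‖) ^ 2 := by rw [realObjective, ht]; ring
    _ ≤ a * ‖v‖ ^ 2 + b * ‖w‖ ^ 2 := by
        gcongr <;> exact mul_le_of_le_one_left (norm_nonneg _) ht₁
    _ ≤ pointObjective z p₀ q₀ a b v w := by
        rw [pointObjective, add_assoc]
        exact le_add_of_nonneg_left (by positivity)

lemma isPointMin_of_forall_nonneg (hp₀ : 0 ≤ p₀) (hq₀ : 0 ≤ q₀) (ha : 0 ≤ a) (hb : 0 ≤ b)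
    (hz : p₀ * q₀ ≤ z)
    (h : ∀ v w, 0 ≤ v → 0 ≤ w → realObjective z p₀ q₀ a b p q ≤ realObjective z p₀ q₀ a b v w) :
    IsPointMin z p₀ q₀ a b p q := fun v w => by
  obtain ⟨p', q', hp', hq', hle⟩ := exists_realObjective_le_pointObjective hp₀ hq₀ ha hb hz v w
  rw [pointObjective_ofReal]
  exact (h p' q' hp' hq').trans hle

lemma two_mul_mul_mul_le {c : ℝ} (ha : 0 ≤ a) (hb : 0 ≤ b) (hc : c ^ 2 ≤ a * b) (p q : ℝ) :
    2 * c * (p * q) ≤ a * p ^ 2 + b * q ^ 2 := by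
  refine le_of_abs_le (abs_le_of_sq_le_sq ?_ (by positivity))
  calc (2 * c * (p * q)) ^ 2 = 4 * c ^ 2 * (p * q) ^ 2 := by ring
    _ ≤ 4 * (a * b) * (p * q) ^ 2 := by gcongr
    _ ≤ (a * p ^ 2 + b * q ^ 2) ^ 2 := by linarith [sq_nonneg (a * p ^ 2 - b * q ^ 2)]

lemma exists_realObjective_lt_sq (hb : 0 < b) (hz : 0 < z) (hab : a * b < z ^ 2) :
    ∃ p q, realObjective z 0 0 a b p q < z ^ 2 := by
  -- `t` minimizes the objective along `(√t * b, √t * z)`, a quadratic polynomial in `t`.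
  set t := (z ^ 2 - a * b) / (2 * b * z ^ 2) with ht_def
  have h_gap : 0 < z ^ 2 - a * b := sub_pos.2 hab
  have ht : 0 < t := by positivity
  have ht_mul : t * (2 * b * z ^ 2) = z ^ 2 - a * b := by rw [ht_def]; field_simp
  refine ⟨√t * b, √t * z, ?_⟩
  calc realObjective z 0 0 a b (√t * b) (√t * z)
      = z ^ 2 - √t ^ 2 * b * (z ^ 2 - a * b) + (√t ^ 2) ^ 2 * b ^ 2 * z ^ 2 := by
        unfold realObjective; ring
    _ = z ^ 2 - t * b * (z ^ 2 - a * b) / 2 := by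
        rw [Real.sq_sqrt ht.le, ← ht_mul]; ring
    _ < z ^ 2 := sub_lt_self _ (by positivity)

namespace IsRealMin

lemma swap (h : IsRealMin z p₀ q₀ a b p q) : IsRealMin z q₀ p₀ b a q p := fun v w => by
  simpa only [realObjective_swap] using h w v

lemma image_eq (h : IsRealMin z p₀ q₀ a b p q) :
    a * p = (z - (p + p₀) * (q + q₀)) * (q + q₀) := by
  have h_deriv : HasDerivAt (fun v => realObjective z p₀ q₀ a b v q)
      (2 * (z - (p + p₀) * (q + q₀)) * -(q + q₀) + a * (2 * p)) p := by
    have h_residual : HasDerivAt (fun v => z - (v + p₀) * (q + q₀)) (-(q + q₀)) p := by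
      simpa using (((hasDerivAt_id p).add_const p₀).mul_const (q + q₀)).const_sub z
    have h_sq : HasDerivAt (fun v => a * v ^ 2) (a * (2 * p)) p := by
      simpa using (hasDerivAt_pow 2 p).const_mul a
    simpa [realObjective] using ((h_residual.pow 2).add h_sq).add_const (b * q ^ 2)
  have h_zero := IsLocalMin.hasDerivAt_eq_zero (.of_forall fun v => h v q) h_deriv
  linarith

lemma kernel_eq (h : IsRealMin z p₀ q₀ a b p q) :
    b * q = (z - (p + p₀) * (q + q₀)) * (p + p₀) := by
  rw [h.swap.image_eq]
  ring

lemma image_sq_le (h : IsRealMin z p₀ q₀ a b p q) (hb : 0 ≤ b) (hp₀ : 0 ≤ p₀) (hq₀ : 0 ≤ q₀)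
    (hz : p₀ * q₀ ≤ z) : a * p ^ 2 ≤ z ^ 2 := calc
  a * p ^ 2 ≤ realObjective z p₀ q₀ a b p q := by
    unfold realObjective
    linarith [sq_nonneg (z - (p + p₀) * (q + q₀)), mul_nonneg hb (sq_nonneg q)]
  _ ≤ realObjective z p₀ q₀ a b 0 0 := h 0 0
  _ = (z - p₀ * q₀) ^ 2 := by unfold realObjective; ring
  _ ≤ z ^ 2 := pow_le_pow_left₀ (sub_nonneg.2 hz) (sub_le_self _ (mul_nonneg hp₀ hq₀)) 2

lemma kernel_sq_le (h : IsRealMin z p₀ q₀ a b p q) (ha : 0 ≤ a) (hp₀ : 0 ≤ p₀) (hq₀ : 0 ≤ q₀)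
    (hz : p₀ * q₀ ≤ z) : b * q ^ 2 ≤ z ^ 2 :=
  h.swap.image_sq_le ha hq₀ hp₀ (mul_comm p₀ q₀ ▸ hz)

lemma mul_le (h : IsRealMin z p₀ q₀ a b p q) (ha : 0 < a) (hb : 0 < b) (hp₀ : 0 ≤ p₀)
    (hq₀ : 0 ≤ q₀) (hz : p₀ * q₀ ≤ z) (hp : 0 ≤ p) : (p + p₀) * (q + q₀) ≤ z := by
  by_contra! h_lt
  have h_residual : z - (p + p₀) * (q + q₀) ≤ 0 := by linarith
  have hz₀ : 0 ≤ z := (mul_nonneg hp₀ hq₀).trans hz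
  have hQ : 0 ≤ q + q₀ := (pos_of_mul_pos_right (hz₀.trans_lt h_lt) (add_nonneg hp hp₀)).le
  have hp_zero : p = 0 := hp.antisymm' <| nonpos_of_mul_nonpos_right
    (h.image_eq.trans_le (mul_nonpos_of_nonpos_of_nonneg h_residual hQ)) ha
  have hq_nonpos : q ≤ 0 := nonpos_of_mul_nonpos_right
    (h.kernel_eq.trans_le (mul_nonpos_of_nonpos_of_nonneg h_residual (add_nonneg hp hp₀))) hb
  have h_le : (p + p₀) * (q + q₀) ≤ p₀ * q₀ := by
    rw [hp_zero, zero_add]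
    exact mul_le_mul_of_nonneg_left (by linarith) hp₀
  linarith

lemma kernel_nonneg (h : IsRealMin z p₀ q₀ a b p q) (ha : 0 < a) (hb : 0 < b) (hp₀ : 0 ≤ p₀)
    (hq₀ : 0 ≤ q₀) (hz : p₀ * q₀ ≤ z) (hp : 0 ≤ p) : 0 ≤ q :=
  nonneg_of_mul_nonneg_right (h.kernel_eq.symm ▸
    mul_nonneg (sub_nonneg.2 (h.mul_le ha hb hp₀ hq₀ hz hp)) (add_nonneg hp hp₀)) hb

lemma mul_lt (h : IsRealMin z p₀ q₀ a b p q) (ha : 0 < a) (hb : 0 < b) (hp₀ : 0 ≤ p₀)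
    (hq₀ : 0 ≤ q₀) (hz : p₀ * q₀ < z) (hp : 0 ≤ p) : (p + p₀) * (q + q₀) < z := by
  refine (h.mul_le ha hb hp₀ hq₀ hz.le hp).lt_of_ne fun h_eq => hz.ne ?_
  have h_image := h.image_eq
  have h_kernel := h.kernel_eq
  rw [h_eq, sub_self, zero_mul] at h_image h_kernel
  have hp_zero : p = 0 := (mul_eq_zero.1 h_image).resolve_left ha.ne'
  have hq_zero : q = 0 := (mul_eq_zero.1 h_kernel).resolve_left hb.ne'
  simpa [hp_zero, hq_zero] using h_eq

lemma image_pos (h : IsRealMin z p₀ q₀ a b p q) (ha : 0 < a) (hb : 0 < b) (hp₀ : 0 ≤ p₀)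
    (hq₀ : 0 ≤ q₀) (hz : p₀ * q₀ < z) (hab : a * b < z ^ 2) (hp : 0 ≤ p) : 0 < p := by
  refine hp.lt_of_ne' fun hp_zero => ?_
  have h_residual := sub_pos.2 (h.mul_lt ha hb hp₀ hq₀ hz hp)
  have hq := h.kernel_nonneg ha hb hp₀ hq₀ hz.le hp
  have hQ_zero : q + q₀ = 0 := by
    have h_image : (z - (p + p₀) * (q + q₀)) * (q + q₀) = 0 := by
      rw [← h.image_eq, hp_zero, mul_zero]
    exact (mul_eq_zero.1 h_image).resolve_left h_residual.ne'
  obtain ⟨rfl, rfl⟩ : q = 0 ∧ q₀ = 0 := (add_eq_zero_iff_of_nonneg hq hq₀).1 hQ_zero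
  obtain rfl : p₀ = 0 := by
    have h_kernel : (z - (p + p₀) * (0 + 0)) * (p + p₀) = 0 := by rw [← h.kernel_eq, mul_zero]
    simpa [hp_zero] using (mul_eq_zero.1 h_kernel).resolve_left h_residual.ne'
  obtain ⟨v, w, hvw⟩ := exists_realObjective_lt_sq hb (by simpa using hz) hab
  refine (h v w).not_gt (hvw.trans_eq ?_)
  rw [hp_zero, realObjective]
  ring

lemma eq_zero_of_sq_le (h : IsRealMin z 0 0 a b p q) (ha : 0 < a) (hb : 0 < b)
    (hz : z ^ 2 ≤ a * b) : p = 0 ∧ q = 0 := by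
  have h_le : realObjective z 0 0 a b p q ≤ realObjective z 0 0 a b 0 0 := h 0 0
  have h_amgm := two_mul_mul_mul_le ha.le hb.le hz p q
  simp only [realObjective, add_zero, mul_zero, sub_zero] at h_le
  have h_mul : p * q = 0 := pow_eq_zero_iff two_ne_zero |>.1 <|
    (sq_nonneg _).antisymm' (by linarith)
  rw [h_mul] at h_le
  have hp_sq : 0 ≤ a * p ^ 2 := by positivity
  have hq_sq : 0 ≤ b * q ^ 2 := by positivity
  constructor
  · simpa [ha.ne'] using hp_sq.antisymm' (by linarith)
  · simpa [hb.ne'] using hq_sq.antisymm' (by linarith)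

end IsRealMin

/-- The kernel increment that is optimal for the image increment `p`. -/
def bestKernel (z p₀ q₀ b p : ℝ) : ℝ := (z - (p + p₀) * q₀) * (p + p₀) / ((p + p₀) ^ 2 + b)

/-- The real objective, minimized over the kernel increment. -/
def reducedObjective (z p₀ q₀ a b p : ℝ) : ℝ :=
  b * (z - (p + p₀) * q₀) ^ 2 / ((p + p₀) ^ 2 + b) + a * p ^ 2

lemma realObjective_eq_reducedObjective_add (hb : 0 < b) (z p₀ q₀ a p q : ℝ) :
    realObjective z p₀ q₀ a b p q = reducedObjective z p₀ q₀ a b p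
      + ((p + p₀) ^ 2 + b) * (q - bestKernel z p₀ q₀ b p) ^ 2 := by
  have h : (p + p₀) ^ 2 + b ≠ 0 := by positivity
  unfold realObjective reducedObjective bestKernel
  field_simp
  ring

lemma realObjective_bestKernel (hb : 0 < b) (z p₀ q₀ a p : ℝ) :
    realObjective z p₀ q₀ a b p (bestKernel z p₀ q₀ b p) = reducedObjective z p₀ q₀ a b p := by
  rw [realObjective_eq_reducedObjective_add hb]
  ring

lemma reducedObjective_le_realObjective (hb : 0 < b) (z p₀ q₀ a p q : ℝ) :
    reducedObjective z p₀ q₀ a b p ≤ realObjective z p₀ q₀ a b p q := by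
  rw [realObjective_eq_reducedObjective_add hb]
  exact le_add_of_nonneg_right (by positivity)

lemma continuous_reducedObjective (hb : 0 < b) (z p₀ q₀ a : ℝ) :
    Continuous (reducedObjective z p₀ q₀ a b) := by
  unfold reducedObjective
  fun_prop (disch := intro; positivity)

lemma exists_forall_reducedObjective_le (ha : 0 < a) (hb : 0 < b) (z p₀ q₀ : ℝ) :
    ∃ p : ℝ≥0, ∀ p' : ℝ≥0, reducedObjective z p₀ q₀ a b p ≤ reducedObjective z p₀ q₀ a b p' := by
  refine ((continuous_reducedObjective hb z p₀ q₀ a).comp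
    NNReal.continuous_coe).exists_forall_le ?_
  have h_sq : Tendsto (fun p : ℝ≥0 => a * (p : ℝ) ^ 2) atTop atTop :=
    ((tendsto_pow_atTop two_ne_zero).comp
      (NNReal.tendsto_coe_atTop.2 tendsto_id)).const_mul_atTop ha
  rw [cocompact_eq_atTop]
  exact tendsto_atTop_mono (fun p => le_add_of_nonneg_left (by positivity)) h_sq

/-- The image increment of one step of the pointwise iteration, among nonnegative increments. -/
def imageStep (z p₀ q₀ a b : ℝ) : ℝ :=
  (leastArgmin fun p : ℝ≥0 => reducedObjective z p₀ q₀ a b p : ℝ≥0)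

/-- The kernel increment of one step of the pointwise iteration. -/
def kernelStep (z p₀ q₀ a b : ℝ) : ℝ := bestKernel z p₀ q₀ b (imageStep z p₀ q₀ a b)

lemma imageStep_nonneg (z p₀ q₀ a b : ℝ) : 0 ≤ imageStep z p₀ q₀ a b := NNReal.coe_nonneg _

lemma isPointMin_step (ha : 0 < a) (hb : 0 < b) (hp₀ : 0 ≤ p₀) (hq₀ : 0 ≤ q₀) (hz : p₀ * q₀ ≤ z) :
    IsPointMin z p₀ q₀ a b (imageStep z p₀ q₀ a b) (kernelStep z p₀ q₀ a b) := by
  refine isPointMin_of_forall_nonneg hp₀ hq₀ ha.le hb.le hz fun v w hv _ => ?_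
  calc realObjective z p₀ q₀ a b (imageStep z p₀ q₀ a b) (kernelStep z p₀ q₀ a b)
      = reducedObjective z p₀ q₀ a b (imageStep z p₀ q₀ a b) :=
        realObjective_bestKernel hb _ _ _ _ _
    _ ≤ reducedObjective z p₀ q₀ a b v :=
        apply_leastArgmin_le ((continuous_reducedObjective hb z p₀ q₀ a).comp NNReal.continuous_coe)
          (exists_forall_reducedObjective_le ha hb z p₀ q₀) ⟨v, hv⟩
    _ ≤ realObjective z p₀ q₀ a b v w := reducedObjective_le_realObjective hb _ _ _ _ _ _

/-- The invariant of the pointwise iteration for the datum `z`, where `c` is the product of the two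
penalty weights: the iterates `p₀` and `q₀` still vanish if `z` is below the threshold `√c`, and
their product has not reached `z` otherwise. -/
structure IsAdmissible (z c p₀ q₀ : ℝ) : Prop where
  image_nonneg : 0 ≤ p₀
  kernel_nonneg : 0 ≤ q₀
  mul_lt : c < z ^ 2 → p₀ * q₀ < z
  eq_zero : z ^ 2 ≤ c → p₀ = 0 ∧ q₀ = 0

namespace IsAdmissible

lemma mul_le {c : ℝ} (h : IsAdmissible z c p₀ q₀) (hz : 0 ≤ z) : p₀ * q₀ ≤ z := by
  rcases lt_or_ge c (z ^ 2) with hc | hc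
  · exact (h.mul_lt hc).le
  · simpa [h.eq_zero hc] using hz

lemma mono {c c' : ℝ} (h : IsAdmissible z c p₀ q₀) (hz : 0 ≤ z) (hc' : 0 ≤ c') (hcc' : c' ≤ c) :
    IsAdmissible z c' p₀ q₀ where
  image_nonneg := h.image_nonneg
  kernel_nonneg := h.kernel_nonneg
  mul_lt hc'z := by
    rcases lt_or_ge c (z ^ 2) with hc | hc
    · exact h.mul_lt hc
    · have hz_pos : 0 < z := hz.lt_of_ne' (sq_pos_iff.1 (hc'.trans_lt hc'z))
      simpa [h.eq_zero hc] using hz_pos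
  eq_zero hc'z := h.eq_zero (hc'z.trans hcc')

variable (h : IsAdmissible z (a * b) p₀ q₀) (hz : 0 ≤ z) (ha : 0 < a) (hb : 0 < b)
include h hz ha hb

lemma isPointMin_step : IsPointMin z p₀ q₀ a b (imageStep z p₀ q₀ a b) (kernelStep z p₀ q₀ a b) :=
  BlindMHDM.isPointMin_step ha hb h.image_nonneg h.kernel_nonneg (h.mul_le hz)

lemma kernelStep_nonneg : 0 ≤ kernelStep z p₀ q₀ a b :=
  (h.isPointMin_step hz ha hb).isRealMin.kernel_nonneg ha hb h.image_nonneg h.kernel_nonneg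
    (h.mul_le hz) (imageStep_nonneg _ _ _ _ _)

lemma imageStep_pos (hab : a * b < z ^ 2) : 0 < imageStep z p₀ q₀ a b :=
  (h.isPointMin_step hz ha hb).isRealMin.image_pos ha hb h.image_nonneg h.kernel_nonneg
    (h.mul_lt hab) hab (imageStep_nonneg _ _ _ _ _)

lemma step_eq_zero (hab : z ^ 2 ≤ a * b) :
    imageStep z p₀ q₀ a b = 0 ∧ kernelStep z p₀ q₀ a b = 0 := by
  have h_min := (h.isPointMin_step hz ha hb).isRealMin
  obtain ⟨rfl, rfl⟩ := h.eq_zero hab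
  exact h_min.eq_zero_of_sq_le ha hb hab

lemma step : IsAdmissible z (a * b) (imageStep z p₀ q₀ a b + p₀) (kernelStep z p₀ q₀ a b + q₀) where
  image_nonneg := add_nonneg (imageStep_nonneg _ _ _ _ _) h.image_nonneg
  kernel_nonneg := add_nonneg (h.kernelStep_nonneg hz ha hb) h.kernel_nonneg
  mul_lt hab := (h.isPointMin_step hz ha hb).isRealMin.mul_lt ha hb h.image_nonneg h.kernel_nonneg
    (h.mul_lt hab) (imageStep_nonneg _ _ _ _ _)
  eq_zero hab := by simpa [h.step_eq_zero hz ha hb hab] using h.eq_zero hab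

end IsAdmissible

/-- The soft thresholding of `z` at the level `c`. -/
def softThreshold (c z : ℝ) : ℝ := max (z - c) 0

lemma softThreshold_nonneg (c z : ℝ) : 0 ≤ softThreshold c z := le_max_right _ _

lemma softThreshold_objective_le (c z : ℝ) {t : ℝ} (ht : 0 ≤ t) :
    (z - softThreshold c z) ^ 2 + 2 * c * softThreshold c z ≤ (z - t) ^ 2 + 2 * c * t := by
  unfold softThreshold
  rcases le_total c z with h | h
  · rw [max_eq_left (sub_nonneg.2 h)]
    linarith [sq_nonneg (z - c - t)]
  · rw [max_eq_right (sub_nonpos.2 h)]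
    linarith [mul_nonneg ht (sub_nonneg.2 h), sq_nonneg t]

/-- The modulus of the first image iterate at a frequency where the datum has modulus `z`; with `a`
and `b` exchanged, that of the first kernel iterate. -/
def initAmplitude (z a b : ℝ) : ℝ := √(max (√(b / a) * z - b) 0)

lemma initAmplitude_nonneg (z a b : ℝ) : 0 ≤ initAmplitude z a b := Real.sqrt_nonneg _

lemma initAmplitude_sq (ha : 0 < a) (hb : 0 < b) (z : ℝ) :
    initAmplitude z a b ^ 2 = √(b / a) * softThreshold √(a * b) z := by
  have h_sqrt : √(b / a) * √(a * b) = b := by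
    rw [← Real.sqrt_mul (by positivity), show b / a * (a * b) = b ^ 2 by field_simp,
      Real.sqrt_sq hb.le]
  rw [initAmplitude, Real.sq_sqrt (le_max_right _ _), softThreshold,
    mul_max_of_nonneg _ _ (Real.sqrt_nonneg _), mul_sub, h_sqrt, mul_zero]

lemma mul_initAmplitude_sq (ha : 0 < a) (hb : 0 < b) (z : ℝ) :
    a * initAmplitude z a b ^ 2 = √(a * b) * softThreshold √(a * b) z := by
  have h_sqrt : a * √(b / a) = √(a * b) := by
    rw [show a * b = a ^ 2 * (b / a) by field_simp, Real.sqrt_mul (sq_nonneg a), Real.sqrt_sq ha.le]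
  rw [initAmplitude_sq ha hb, ← mul_assoc, h_sqrt]

lemma initAmplitude_mul (ha : 0 < a) (hb : 0 < b) (z : ℝ) :
    initAmplitude z a b * initAmplitude z b a = softThreshold √(a * b) z := by
  have h_sqrt : √(b / a) * √(a / b) = 1 := by
    rw [← Real.sqrt_mul (by positivity), show b / a * (a / b) = 1 by field_simp, Real.sqrt_one]
  refine (sq_eq_sq₀ (mul_nonneg (initAmplitude_nonneg _ _ _) (initAmplitude_nonneg _ _ _))
    (softThreshold_nonneg _ _)).1 ?_
  rw [mul_pow, initAmplitude_sq ha hb, initAmplitude_sq hb ha, mul_comm b a]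
  linear_combination softThreshold √(a * b) z ^ 2 * h_sqrt

lemma isPointMin_initAmplitude (ha : 0 < a) (hb : 0 < b) (hz : 0 ≤ z) :
    IsPointMin z (0 : ℝ) (0 : ℝ) a b (initAmplitude z a b) (initAmplitude z b a) := by
  refine isPointMin_of_forall_nonneg le_rfl le_rfl ha.le hb.le (by simpa using hz)
    fun v w hv hw => ?_
  simp only [realObjective, add_zero]
  calc (z - initAmplitude z a b * initAmplitude z b a) ^ 2 + a * initAmplitude z a b ^ 2
        + b * initAmplitude z b a ^ 2
      = (z - softThreshold √(a * b) z) ^ 2 + 2 * √(a * b) * softThreshold √(a * b) z := by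
        rw [initAmplitude_mul ha hb, mul_initAmplitude_sq ha hb, mul_initAmplitude_sq hb ha,
          mul_comm b a]
        ring
    _ ≤ (z - v * w) ^ 2 + 2 * √(a * b) * (v * w) :=
        softThreshold_objective_le _ _ (mul_nonneg hv hw)
    _ ≤ (z - v * w) ^ 2 + a * v ^ 2 + b * w ^ 2 := by
        have h_amgm := two_mul_mul_mul_le ha.le hb.le (Real.sq_sqrt (mul_pos ha hb).le).le v w
        linarith

lemma initAmplitude_eq_zero (ha : 0 < a) (hb : 0 < b) (h : z ^ 2 ≤ a * b) :
    initAmplitude z a b = 0 := by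
  rw [← sq_eq_zero_iff, initAmplitude_sq ha hb, softThreshold,
    max_eq_right (sub_nonpos.2 (Real.le_sqrt_of_sq_le h)), mul_zero]

lemma isAdmissible_initAmplitude (ha : 0 < a) (hb : 0 < b) (hz : 0 ≤ z) :
    IsAdmissible z (a * b) (initAmplitude z a b) (initAmplitude z b a) where
  image_nonneg := initAmplitude_nonneg _ _ _
  kernel_nonneg := initAmplitude_nonneg _ _ _
  mul_lt hab := by
    have hz_pos : 0 < z := hz.lt_of_ne' (sq_pos_iff.1 ((mul_pos ha hb).trans hab))
    rw [initAmplitude_mul ha hb]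
    exact max_lt (sub_lt_self _ (by positivity)) hz_pos
  eq_zero hab := ⟨initAmplitude_eq_zero ha hb hab, initAmplitude_eq_zero hb ha (mul_comm a b ▸ hab)⟩

end Pointwise

section Amplitudes

/-- The moduli of the image and kernel iterates at a frequency where the datum has modulus `z` and
the penalties of the `n`-th step have the weights `a n` and `b n`. -/
def amplitudes (z : ℝ) (a b : ℕ → ℝ) : ℕ → ℝ × ℝ
  | 0 => (initAmplitude z (a 0) (b 0), initAmplitude z (b 0) (a 0))
  | n + 1 =>
    let (p₀, q₀) := amplitudes z a b n
    (imageStep z p₀ q₀ (a (n + 1)) (b (n + 1)) + p₀,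
      kernelStep z p₀ q₀ (a (n + 1)) (b (n + 1)) + q₀)

/-- The modulus of the `n`-th image iterate. -/
def imageAmplitude (z : ℝ) (a b : ℕ → ℝ) (n : ℕ) : ℝ := (amplitudes z a b n).1

/-- The modulus of the `n`-th kernel iterate. -/
def kernelAmplitude (z : ℝ) (a b : ℕ → ℝ) (n : ℕ) : ℝ := (amplitudes z a b n).2

section

variable (z : ℝ) (a b : ℕ → ℝ) (n : ℕ)

lemma imageAmplitude_succ_sub :
    imageAmplitude z a b (n + 1) - imageAmplitude z a b n =
      imageStep z (imageAmplitude z a b n) (kernelAmplitude z a b n) (a (n + 1)) (b (n + 1)) :=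
  add_sub_cancel_right _ _

lemma kernelAmplitude_succ_sub :
    kernelAmplitude z a b (n + 1) - kernelAmplitude z a b n =
      kernelStep z (imageAmplitude z a b n) (kernelAmplitude z a b n) (a (n + 1)) (b (n + 1)) :=
  add_sub_cancel_right _ _

end

section Minimality

variable {z : ℝ} {a b : ℕ → ℝ} (hz : 0 ≤ z) (ha : ∀ n, 0 < a n) (hb : ∀ n, 0 < b n)
  (hab : Antitone fun n => a n * b n)
include hz ha hb hab

lemma isAdmissible_amplitudes (n : ℕ) :
    IsAdmissible z (a n * b n) (imageAmplitude z a b n) (kernelAmplitude z a b n) := by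
  induction n with
  | zero => exact isAdmissible_initAmplitude (ha 0) (hb 0) hz
  | succ n ih =>
    exact (ih.mono hz (mul_pos (ha _) (hb _)).le (hab n.le_succ)).step hz (ha _) (hb _)

lemma isAdmissible_amplitudes_succ (n : ℕ) :
    IsAdmissible z (a (n + 1) * b (n + 1)) (imageAmplitude z a b n) (kernelAmplitude z a b n) :=
  (isAdmissible_amplitudes hz ha hb hab n).mono hz (mul_pos (ha _) (hb _)).le (hab n.le_succ)

lemma isPointMin_amplitudes_sub (n : ℕ) :
    IsPointMin z (imageAmplitude z a b n) (kernelAmplitude z a b n) (a (n + 1)) (b (n + 1))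
      ↑(imageAmplitude z a b (n + 1) - imageAmplitude z a b n)
      ↑(kernelAmplitude z a b (n + 1) - kernelAmplitude z a b n) := by
  rw [imageAmplitude_succ_sub, kernelAmplitude_succ_sub]
  exact (isAdmissible_amplitudes_succ hz ha hb hab n).isPointMin_step hz (ha _) (hb _)

lemma kernelAmplitude_le_succ (n : ℕ) : kernelAmplitude z a b n ≤ kernelAmplitude z a b (n + 1) :=
  sub_nonneg.1 <| (kernelAmplitude_succ_sub z a b n).symm ▸
    (isAdmissible_amplitudes_succ hz ha hb hab n).kernelStep_nonneg hz (ha _) (hb _)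

lemma imageAmplitude_lt_succ {n : ℕ} (h : a (n + 1) * b (n + 1) < z ^ 2) :
    imageAmplitude z a b n < imageAmplitude z a b (n + 1) :=
  sub_pos.1 <| (imageAmplitude_succ_sub z a b n).symm ▸
    (isAdmissible_amplitudes_succ hz ha hb hab n).imageStep_pos hz (ha _) (hb _) h

lemma amplitudes_sub_eq_zero {n : ℕ} (h : z ^ 2 ≤ a (n + 1) * b (n + 1)) :
    imageAmplitude z a b (n + 1) - imageAmplitude z a b n = 0 ∧
      kernelAmplitude z a b (n + 1) - kernelAmplitude z a b n = 0 := by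
  rw [imageAmplitude_succ_sub, kernelAmplitude_succ_sub]
  exact (isAdmissible_amplitudes_succ hz ha hb hab n).step_eq_zero hz (ha _) (hb _) h

lemma mul_imageAmplitude_sub_sq_le (n : ℕ) :
    a (n + 1) * (imageAmplitude z a b (n + 1) - imageAmplitude z a b n) ^ 2 ≤ z ^ 2 :=
  have h := isAdmissible_amplitudes_succ hz ha hb hab n
  (isPointMin_amplitudes_sub hz ha hb hab n).isRealMin.image_sq_le (hb _).le h.image_nonneg
    h.kernel_nonneg (h.mul_le hz)

lemma mul_kernelAmplitude_sub_sq_le (n : ℕ) :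
    b (n + 1) * (kernelAmplitude z a b (n + 1) - kernelAmplitude z a b n) ^ 2 ≤ z ^ 2 :=
  have h := isAdmissible_amplitudes_succ hz ha hb hab n
  (isPointMin_amplitudes_sub hz ha hb hab n).isRealMin.kernel_sq_le (ha _).le h.image_nonneg
    h.kernel_nonneg (h.mul_le hz)

end Minimality

lemma mul_initAmplitude_sq_le {z a b : ℝ} (hz : 0 ≤ z) (ha : 0 < a) (hb : 0 < b) :
    a * initAmplitude z a b ^ 2 ≤ z ^ 2 :=
  (isPointMin_initAmplitude ha hb hz).isRealMin.image_sq_le hb.le le_rfl le_rfl (by simpa using hz)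

section Measurability

variable {X : Type*} [MeasurableSpace X]

lemma measurable_initAmplitude {z a b : X → ℝ} (hz : Measurable z) (ha : Measurable a)
    (hb : Measurable b) : Measurable fun x => initAmplitude (z x) (a x) (b x) := by
  unfold initAmplitude
  fun_prop

lemma measurable_imageStep {z p₀ q₀ a b : X → ℝ} (hz : Measurable z) (hp₀ : Measurable p₀)
    (hq₀ : Measurable q₀) (ha : Measurable a) (hb : Measurable b) (ha_pos : ∀ x, 0 < a x)
    (hb_pos : ∀ x, 0 < b x) :
    Measurable fun x => imageStep (z x) (p₀ x) (q₀ x) (a x) (b x) := by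
  have h_cont (x : X) :
      Continuous fun p : ℝ≥0 => reducedObjective (z x) (p₀ x) (q₀ x) (a x) (b x) p :=
    (continuous_reducedObjective (hb_pos x) _ _ _ _).comp NNReal.continuous_coe
  refine (measurable_leastArgmin (fun p => ?_) h_cont
    fun x => exists_forall_reducedObjective_le (ha_pos x) (hb_pos x) _ _ _).coe_nnreal_real
  unfold reducedObjective
  fun_prop

lemma measurable_kernelStep {z p₀ q₀ a b : X → ℝ} (hz : Measurable z) (hp₀ : Measurable p₀)
    (hq₀ : Measurable q₀) (ha : Measurable a) (hb : Measurable b) (ha_pos : ∀ x, 0 < a x)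
    (hb_pos : ∀ x, 0 < b x) :
    Measurable fun x => kernelStep (z x) (p₀ x) (q₀ x) (a x) (b x) := by
  have h_image := measurable_imageStep hz hp₀ hq₀ ha hb ha_pos hb_pos
  unfold kernelStep bestKernel
  fun_prop

lemma measurable_amplitudes {z : X → ℝ} {a b : X → ℕ → ℝ} (hz : Measurable z)
    (ha : ∀ n, Measurable fun x => a x n) (hb : ∀ n, Measurable fun x => b x n)
    (ha_pos : ∀ x n, 0 < a x n) (hb_pos : ∀ x n, 0 < b x n) (n : ℕ) :
    Measurable fun x => amplitudes (z x) (a x) (b x) n := by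
  induction n with
  | zero =>
    exact (measurable_initAmplitude hz (ha 0) (hb 0)).prodMk
      (measurable_initAmplitude hz (hb 0) (ha 0))
  | succ n ih =>
    have ha_pos' (x : X) := ha_pos x (n + 1)
    have hb_pos' (x : X) := hb_pos x (n + 1)
    exact ((measurable_imageStep hz ih.fst ih.snd (ha _) (hb _) ha_pos' hb_pos').add ih.fst).prodMk
      ((measurable_kernelStep hz ih.fst ih.snd (ha _) (hb _) ha_pos' hb_pos').add ih.snd)

end Measurability

end Amplitudes

section Phase

lemma norm_sgn {z : ℂ} (hz : z ≠ 0) : ‖sgn z‖ = 1 := by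
  rw [sgn, norm_div, Complex.norm_real, norm_norm, div_self (norm_ne_zero_iff.2 hz)]

lemma sgn_zero : sgn 0 = 0 := zero_div _

lemma norm_sgn_le_one (z : ℂ) : ‖sgn z‖ ≤ 1 := by
  rcases eq_or_ne z 0 with rfl | hz
  · simp [sgn_zero]
  · exact (norm_sgn hz).le

lemma sgn_conj (z : ℂ) : sgn (conj z) = conj (sgn z) := by simp [sgn]

lemma sgn_mul_norm (z : ℂ) : sgn z * ‖z‖ = z :=
  div_mul_cancel_of_imp fun h => norm_eq_zero.1 (Complex.ofReal_eq_zero.1 h)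

lemma sgn_sgn_mul_ofReal (z : ℂ) {t : ℝ} (ht : 0 < t) : sgn (sgn z * t) = sgn z := by
  rcases eq_or_ne z 0 with rfl | hz
  · simp [sgn_zero]
  · have h_norm : ‖sgn z * t‖ = t := by
      rw [norm_mul, norm_sgn hz, one_mul, Complex.norm_of_nonneg ht.le]
    rw [sgn, h_norm, mul_div_cancel_right₀ _ (Complex.ofReal_ne_zero.2 ht.ne')]

lemma pointObjective_sgn_mul {z : ℂ} (hz : z ≠ 0) (p₀ q₀ : ℂ) (a b : ℝ) (v w : ℂ) :
    pointObjective z (sgn z * p₀) q₀ a b (sgn z * v) w = pointObjective ‖z‖ p₀ q₀ a b v w := by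
  have h_residual : z - (sgn z * v + sgn z * p₀) * (w + q₀) =
      sgn z * (‖z‖ - (v + p₀) * (w + q₀)) := by
    rw [mul_sub, sgn_mul_norm]
    ring
  simp only [pointObjective, h_residual, norm_mul, norm_sgn hz, one_mul]

lemma IsPointMin.sgn_mul {z p₀ q₀ p q : ℂ} {a b : ℝ} (h : IsPointMin ‖z‖ p₀ q₀ a b p q)
    (ha : 0 ≤ a) (hb : 0 ≤ b) (hq : z = 0 → q = 0) :
    IsPointMin z (sgn z * p₀) q₀ a b (sgn z * p) q := fun v w => by
  rcases eq_or_ne z 0 with hz | hz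
  · calc pointObjective z (sgn z * p₀) q₀ a b (sgn z * p) q = 0 := by
          simp [pointObjective, hz, hq hz, sgn_zero]
      _ ≤ pointObjective z (sgn z * p₀) q₀ a b v w := by
          unfold pointObjective
          positivity
  · have h_sgn : sgn z ≠ 0 := norm_ne_zero_iff.1 (norm_sgn hz ▸ one_ne_zero)
    rw [← mul_div_cancel₀ v h_sgn, pointObjective_sgn_mul hz, pointObjective_sgn_mul hz]
    exact h _ _

lemma measurable_sgn : Measurable sgn := by
  unfold sgn
  fun_prop

end Phase

section Frequencies

lemma one_le_Δ (x : Plane) : 1 ≤ Δ x := le_add_of_nonneg_right (sq_nonneg _)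

lemma Δ_pos (x : Plane) : 0 < Δ x := zero_lt_one.trans_le (one_le_Δ x)

lemma Δ_neg (x : Plane) : Δ (-x) = Δ x := by simp [Δ]

lemma measurable_Δ : Measurable Δ := by
  unfold Δ
  fun_prop

/-- The penalty weights at the frequency `x`, when the `n`-th penalty is `c n * ∫ Δ ^ t * |·|²`. -/
def weights (c : ℕ → ℝ) (t : ℝ) (x : Plane) (n : ℕ) : ℝ := c n * Δ x ^ t

lemma weights_pos {c : ℕ → ℝ} (hc : ∀ n, 0 < c n) (t : ℝ) (x : Plane) (n : ℕ) :
    0 < weights c t x n :=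
  mul_pos (hc n) (Real.rpow_pos_of_pos (Δ_pos x) t)

lemma weights_neg (c : ℕ → ℝ) (t : ℝ) (x : Plane) : weights c t (-x) = weights c t x := by
  unfold weights
  rw [Δ_neg]

lemma measurable_weights (c : ℕ → ℝ) (t : ℝ) (n : ℕ) : Measurable fun x => weights c t x n :=
  (measurable_Δ.pow_const t).const_mul (c n)

lemma weights_mul_weights (c d : ℕ → ℝ) (r s : ℝ) (x : Plane) (n : ℕ) :
    weights c r x n * weights d s x n = c n * d n * Δ x ^ (r + s) := by
  rw [weights, weights, Real.rpow_add (Δ_pos x), mul_mul_mul_comm]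

lemma antitone_weights_mul_weights {c d : ℕ → ℝ} (h : Antitone fun n => c n * d n) (r s : ℝ)
    (x : Plane) : Antitone fun n => weights c r x n * weights d s x n := fun m n hmn => by
  simp only [weights_mul_weights]
  exact mul_le_mul_of_nonneg_right (h hmn) (Real.rpow_nonneg (Δ_pos x).le _)

lemma initAmplitude_weights (c d : ℕ → ℝ) (r s z : ℝ) (x : Plane) (n : ℕ) :
    initAmplitude z (weights c r x n) (weights d s x n) =
      √(max (√(d n / c n * Δ x ^ (s - r)) * z - d n * Δ x ^ s) 0) := by
  rw [initAmplitude, weights, weights, Real.rpow_sub (Δ_pos x), mul_div_mul_comm]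

lemma enorm_sq_eq_ofReal {E : Type*} [SeminormedAddCommGroup E] (x : E) :
    ‖x‖ₑ ^ 2 = ENNReal.ofReal (‖x‖ ^ 2) := by
  rw [ENNReal.ofReal_pow (norm_nonneg _), ofReal_norm]

lemma eLpNorm_two_sq {α E : Type*} [MeasurableSpace α] [NormedAddCommGroup E] (μ : Measure α)
    (g : α → E) : eLpNorm g 2 μ ^ 2 = ∫⁻ x, ‖g x‖ₑ ^ 2 ∂μ := by
  simpa using eLpNorm_nnreal_pow_eq_lintegral (μ := μ) (f := g) (p := 2) two_ne_zero

lemma fourierObjective_eq_lintegral (F : L2C) (r s : ℝ) {l m : ℝ} (hl : 0 ≤ l) (hm : 0 ≤ m)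
    (P Q p q : L2C) :
    fourierObjective F r s l m P Q p q = ∫⁻ x, ENNReal.ofReal
      (pointObjective (F x) (P x) (Q x) (l * Δ x ^ r) (m * Δ x ^ s) (p x) (q x)) := by
  have h_meas (c t : ℝ) (g : L2C) :
      Measurable fun x => ENNReal.ofReal c * (ENNReal.ofReal (Δ x ^ t) * ‖g x‖ₑ ^ 2) :=
    ((measurable_Δ.pow_const t).ennreal_ofReal.mul
      ((Lp.stronglyMeasurable g).measurable.enorm.pow_const 2)).const_mul _
  have h_pow (x : Plane) (t : ℝ) : 0 ≤ Δ x ^ t := Real.rpow_nonneg (Δ_pos x).le t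
  rw [fourierObjective, eLpNorm_two_sq, weightedSq, weightedSq,
    ← lintegral_const_mul' _ _ ENNReal.ofReal_ne_top,
    ← lintegral_const_mul' _ _ ENNReal.ofReal_ne_top,
    ← lintegral_add_right _ (h_meas l r p), ← lintegral_add_right _ (h_meas m s q)]
  refine lintegral_congr fun x => ?_
  have hr := h_pow x r
  have hs := h_pow x s
  rw [pointObjective, ENNReal.ofReal_add (by positivity) (by positivity),
    ENNReal.ofReal_add (by positivity) (by positivity), mul_assoc, mul_assoc,
    ENNReal.ofReal_mul hl, ENNReal.ofReal_mul hm, ENNReal.ofReal_mul hr, ENNReal.ofReal_mul hs]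
  simp only [enorm_sq_eq_ofReal]

lemma isFourierStepMin_of_isPointMin {F P Q p q : L2C} {r s l m : ℝ} (hl : 0 ≤ l) (hm : 0 ≤ m)
    (h : ∀ᵐ x, IsPointMin (F x) (P x) (Q x) (l * Δ x ^ r) (m * Δ x ^ s) (p x) (q x)) :
    IsFourierStepMin F r s l m P Q p q := fun v w => by
  rw [fourierObjective_eq_lintegral F r s hl hm, fourierObjective_eq_lintegral F r s hl hm]
  exact lintegral_mono_ae (h.mono fun x hx => ENNReal.ofReal_le_ofReal (hx _ _))

end Frequencies

section Symmetry

lemma ae_comp_neg {p : Plane → Prop} (h : ∀ᵐ x, p x) : ∀ᵐ x, p (-x) :=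
  (Measure.measurePreserving_neg (volume : Measure Plane)).quasiMeasurePreserving.ae h

lemma IsHermitian.add {g h : L2C} (hg : IsHermitian g) (hh : IsHermitian h) :
    IsHermitian (g + h) := by
  have h_add := Lp.coeFn_add g h
  filter_upwards [hg, hh, h_add, ae_comp_neg h_add] with x hgx hhx h_pos h_neg
  rw [h_pos, h_neg, Pi.add_apply, Pi.add_apply, map_add, ← hgx, ← hhx]

lemma IsHermitian.norm_comp_neg {g : L2C} (hg : IsHermitian g) : ∀ᵐ x, ‖g (-x)‖ = ‖g x‖ :=
  hg.mono fun x hx => by rw [hx, Complex.norm_conj]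

lemma isHermitian_of_sgn_mul {F P : L2C} (hF : IsHermitian F) {ρ : Plane → ℝ}
    (hρ : ∀ᵐ x, ρ (-x) = ρ x) (hP : ∀ᵐ x, P x = sgn (F x) * ρ x) : IsHermitian P := by
  filter_upwards [hF, hρ, hP, ae_comp_neg hP] with x hFx hρx h_pos h_neg
  rw [h_neg, h_pos, hρx, map_mul, Complex.conj_ofReal, ← sgn_conj, ← hFx]

lemma isHermitian_of_real {Q : L2C} {κ : Plane → ℝ} (hκ : ∀ᵐ x, κ (-x) = κ x)
    (hQ : ∀ᵐ x, Q x = κ x) : IsHermitian Q := by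
  filter_upwards [hκ, hQ, ae_comp_neg hQ] with x hκx h_pos h_neg
  rw [h_neg, h_pos, hκx, Complex.conj_ofReal]

lemma IsNonneg.add {g h : L2C} (hg : IsNonneg g) (hh : IsNonneg h) : IsNonneg (g + h) := by
  filter_upwards [hg, hh, Lp.coeFn_add g h] with x hgx hhx h_add
  rw [h_add, Pi.add_apply, Complex.add_im, Complex.add_re, hgx.1, hhx.1]
  exact ⟨add_zero 0, add_nonneg hgx.2 hhx.2⟩

lemma isNonneg_of_real {Q : L2C} {κ : Plane → ℝ} (hκ : ∀ x, 0 ≤ κ x) (hQ : ∀ᵐ x, Q x = κ x) :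
    IsNonneg Q :=
  hQ.mono fun x hx => by
    rw [hx]
    exact ⟨Complex.ofReal_im _, hκ x⟩

end Symmetry

namespace IsFourierRecipe

variable {F : L2C} {r s : ℝ} {lam mu : ℕ → ℝ} {P Q : ℕ → L2C}

lemma image_zero (h : IsFourierRecipe F r s lam mu P Q) :
    ∀ᵐ x, P 0 x =
      sgn (F x) * (initAmplitude ‖F x‖ (weights lam r x 0) (weights mu s x 0) : ℝ) := by
  simpa only [initAmplitude_weights] using h.init_image

lemma kernel_zero (h : IsFourierRecipe F r s lam mu P Q) :
    ∀ᵐ x, Q 0 x = (initAmplitude ‖F x‖ (weights mu s x 0) (weights lam r x 0) : ℝ) := by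
  simpa only [initAmplitude_weights] using h.init_kernel

lemma isHermitian_image (h : IsFourierRecipe F r s lam mu P Q) (hF : IsHermitian F) (n : ℕ) :
    IsHermitian (P n) := by
  induction n with
  | zero =>
    exact isHermitian_of_sgn_mul hF
      (hF.norm_comp_neg.mono fun x hx => by rw [hx, weights_neg, weights_neg]) h.image_zero
  | succ n ih =>
    rw [← add_sub_cancel (P n) (P (n + 1))]
    exact ih.add (h.image_symm n)

lemma isHermitian_kernel (h : IsFourierRecipe F r s lam mu P Q) (hF : IsHermitian F) (n : ℕ) :
    IsHermitian (Q n) := by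
  induction n with
  | zero =>
    exact isHermitian_of_real
      (hF.norm_comp_neg.mono fun x hx => by rw [hx, weights_neg, weights_neg]) h.kernel_zero
  | succ n ih =>
    rw [← add_sub_cancel (Q n) (Q (n + 1))]
    refine ih.add ?_
    filter_upwards [h.kernel_symm n, h.kernel_nonneg n] with x h_symm h_nonneg
    rw [← h_symm, Complex.conj_eq_iff_im.2 h_nonneg.1]

lemma isNonneg_kernel (h : IsFourierRecipe F r s lam mu P Q) (n : ℕ) : IsNonneg (Q n) := by
  induction n with
  | zero => exact isNonneg_of_real (fun x => initAmplitude_nonneg _ _ _) h.kernel_zero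
  | succ n ih =>
    rw [← add_sub_cancel (Q n) (Q (n + 1))]
    exact ih.add (h.kernel_nonneg n)

lemma init_min (h : IsFourierRecipe F r s lam mu P Q) (hlam_pos : ∀ n, 0 < lam n)
    (hmu_pos : ∀ n, 0 < mu n) :
    IsFourierStepMin F r s (lam 0) (mu 0) 0 0 (P 0) (Q 0) := by
  refine isFourierStepMin_of_isPointMin (hlam_pos 0).le (hmu_pos 0).le ?_
  filter_upwards [h.image_zero, h.kernel_zero, Lp.coeFn_zero ℂ 2 (volume : Measure Plane)]
    with x h_image h_kernel h_zero
  have ha := weights_pos hlam_pos r x 0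
  have hb := weights_pos hmu_pos s x 0
  have h_min := (isPointMin_initAmplitude ha hb (norm_nonneg (F x))).sgn_mul ha.le hb.le
    fun hF => by simp [hF, initAmplitude_eq_zero hb ha, (mul_pos hb ha).le]
  rw [h_image, h_kernel, h_zero]
  simpa [weights] using h_min

lemma isMHDM {f : L2R} {U K : ℕ → L2R}
    (h : IsFourierRecipe (hat f) r s lam mu (fun n => hat (U n)) fun n => hat (K n))
    (hlam_pos : ∀ n, 0 < lam n) (hmu_pos : ∀ n, 0 < mu n) :
    IsMHDM f r s lam mu U K where
  init := by
    refine IsFourierStepMin.isStepMin ?_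
    rw [hat_zero]
    exact h.init_min hlam_pos hmu_pos
  step n := by
    refine IsFourierStepMin.isStepMin ?_
    rw [hat_sub, hat_sub]
    exact h.step_min n

theorem exists_isMHDM {f : L2R} (h : IsFourierRecipe (hat f) r s lam mu P Q)
    (hlam_pos : ∀ n, 0 < lam n) (hmu_pos : ∀ n, 0 < mu n) :
    ∃ U K : ℕ → L2R, (∀ n, hat (U n) = P n ∧ hat (K n) = Q n) ∧ IsMHDM f r s lam mu U K ∧
      ∀ n, IsNonneg (hat (K n)) := by
  have hF := isHermitian_hat f
  choose U hU using fun n => exists_hat_eq (h.isHermitian_image hF n)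
  choose K hK using fun n => exists_hat_eq (h.isHermitian_kernel hF n)
  obtain rfl : (fun n => hat (U n)) = P := funext hU
  obtain rfl : (fun n => hat (K n)) = Q := funext hK
  exact ⟨U, K, fun n => ⟨rfl, rfl⟩, h.isMHDM hlam_pos hmu_pos, h.isNonneg_kernel⟩

end IsFourierRecipe

section Construction

lemma memLp_of_weight_mul_sq_le {c t : ℝ} (hc : 0 < c) {F : Plane → ℂ}
    (hF : weightedSq (-t) F ≠ ∞) {g : Plane → ℝ} (hg : AEStronglyMeasurable g volume)
    (h : ∀ x, c * Δ x ^ t * g x ^ 2 ≤ ‖F x‖ ^ 2) : MemLp g 2 volume := by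
  have h_le (x : Plane) :
      ‖g x‖ₑ ^ 2 ≤ ENNReal.ofReal c⁻¹ * (ENNReal.ofReal (Δ x ^ (-t)) * ‖F x‖ₑ ^ 2) := by
    have h_pow : 0 < Δ x ^ t := Real.rpow_pos_of_pos (Δ_pos x) t
    have h_real : g x ^ 2 ≤ c⁻¹ * (Δ x ^ (-t) * ‖F x‖ ^ 2) := by
      rw [Real.rpow_neg (Δ_pos x).le, ← mul_assoc, ← mul_inv, inv_mul_eq_div,
        le_div_iff₀ (mul_pos hc h_pow), mul_comm]
      exact h x
    rw [enorm_sq_eq_ofReal, enorm_sq_eq_ofReal, Real.norm_eq_abs, sq_abs,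
      ← ENNReal.ofReal_mul (Real.rpow_nonneg (Δ_pos x).le _),
      ← ENNReal.ofReal_mul (inv_nonneg.2 hc.le)]
    exact ENNReal.ofReal_le_ofReal h_real
  have h_sq : eLpNorm g 2 volume ^ 2 < ∞ := calc
    eLpNorm g 2 volume ^ 2 = ∫⁻ x, ‖g x‖ₑ ^ 2 := eLpNorm_two_sq _ _
    _ ≤ ∫⁻ x, ENNReal.ofReal c⁻¹ * (ENNReal.ofReal (Δ x ^ (-t)) * ‖F x‖ₑ ^ 2) :=
      lintegral_mono h_le
    _ = ENNReal.ofReal c⁻¹ * weightedSq (-t) F :=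
      lintegral_const_mul' _ _ ENNReal.ofReal_ne_top
    _ < ∞ := ENNReal.mul_lt_top ENNReal.ofReal_lt_top hF.lt_top
  exact ⟨hg, (ENNReal.pow_lt_top_iff.1 h_sq).resolve_right two_ne_zero⟩

lemma sobolevSq_neg_ne_top (u : L2R) {t : ℝ} (ht : 0 ≤ t) : sobolevSq (-t) u ≠ ∞ := by
  refine ne_top_of_le_ne_top (ENNReal.pow_ne_top (n := 2) (Lp.eLpNorm_ne_top (hat u))) ?_
  rw [eLpNorm_two_sq]
  refine lintegral_mono fun x => mul_le_of_le_one_left' ?_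
  exact ENNReal.ofReal_le_one.2
    (Real.rpow_le_one_of_one_le_of_nonpos (one_le_Δ x) (neg_nonpos.2 ht))

/-- The iterates `P n` and `Q n` have, at almost every frequency, the moduli of the pointwise
iteration; the images carry the phase of the datum `F` and the kernels are nonnegative. -/
structure HasAmplitudes (F : L2C) (r s : ℝ) (lam mu : ℕ → ℝ) (P Q : ℕ → L2C) : Prop where
  image : ∀ n, ∀ᵐ x, P n x =
    sgn (F x) * (imageAmplitude ‖F x‖ (weights lam r x) (weights mu s x) n : ℝ)
  kernel : ∀ n, ∀ᵐ x, Q n x =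
    (kernelAmplitude ‖F x‖ (weights lam r x) (weights mu s x) n : ℝ)

variable {F : L2C} {r s : ℝ} {lam mu : ℕ → ℝ} (hlam_pos : ∀ n, 0 < lam n)
  (hmu_pos : ∀ n, 0 < mu n)

section Existence

include hlam_pos hmu_pos

lemma measurable_amplitudes_weights (n : ℕ) :
    Measurable fun x => amplitudes ‖F x‖ (weights lam r x) (weights mu s x) n :=
  measurable_amplitudes (Lp.stronglyMeasurable F).measurable.norm (measurable_weights lam r)
    (measurable_weights mu s) (weights_pos hlam_pos r) (weights_pos hmu_pos s) n

variable (h_anti : Antitone fun n => lam n * mu n)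
include h_anti

lemma memLp_imageAmplitude (hF : weightedSq (-r) F ≠ ∞) (n : ℕ) :
    MemLp (fun x => imageAmplitude ‖F x‖ (weights lam r x) (weights mu s x) n) 2 volume := by
  have h_meas (n : ℕ) :
      Measurable fun x => imageAmplitude ‖F x‖ (weights lam r x) (weights mu s x) n :=
    (measurable_amplitudes_weights hlam_pos hmu_pos n).fst
  induction n with
  | zero =>
    exact memLp_of_weight_mul_sq_le (hlam_pos 0) hF (h_meas 0).aestronglyMeasurable fun x =>
      mul_initAmplitude_sq_le (norm_nonneg _) (weights_pos hlam_pos r x 0)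
        (weights_pos hmu_pos s x 0)
  | succ n ih =>
    have h_sub := memLp_of_weight_mul_sq_le (hlam_pos (n + 1)) hF
      ((h_meas (n + 1)).sub (h_meas n)).aestronglyMeasurable fun x =>
        mul_imageAmplitude_sub_sq_le (norm_nonneg _) (weights_pos hlam_pos r x)
          (weights_pos hmu_pos s x) (antitone_weights_mul_weights h_anti r s x) n
    simpa using ih.add h_sub

lemma memLp_kernelAmplitude (hF : weightedSq (-s) F ≠ ∞) (n : ℕ) :
    MemLp (fun x => kernelAmplitude ‖F x‖ (weights lam r x) (weights mu s x) n) 2 volume := by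
  have h_meas (n : ℕ) :
      Measurable fun x => kernelAmplitude ‖F x‖ (weights lam r x) (weights mu s x) n :=
    (measurable_amplitudes_weights hlam_pos hmu_pos n).snd
  induction n with
  | zero =>
    exact memLp_of_weight_mul_sq_le (hmu_pos 0) hF (h_meas 0).aestronglyMeasurable fun x =>
      mul_initAmplitude_sq_le (norm_nonneg _) (weights_pos hmu_pos s x 0)
        (weights_pos hlam_pos r x 0)
  | succ n ih =>
    have h_sub := memLp_of_weight_mul_sq_le (hmu_pos (n + 1)) hF
      ((h_meas (n + 1)).sub (h_meas n)).aestronglyMeasurable fun x =>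
        mul_kernelAmplitude_sub_sq_le (norm_nonneg _) (weights_pos hlam_pos r x)
          (weights_pos hmu_pos s x) (antitone_weights_mul_weights h_anti r s x) n
    simpa using ih.add h_sub

lemma exists_hasAmplitudes (hFr : weightedSq (-r) F ≠ ∞) (hFs : weightedSq (-s) F ≠ ∞) :
    ∃ P Q, HasAmplitudes F r s lam mu P Q := by
  have h_sgn : Measurable fun x => sgn (F x) :=
    measurable_sgn.comp (Lp.stronglyMeasurable F).measurable
  have h_image (n : ℕ) : MemLp (fun x =>
      sgn (F x) * (imageAmplitude ‖F x‖ (weights lam r x) (weights mu s x) n : ℝ)) 2 volume := by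
    have h_memLp := memLp_imageAmplitude hlam_pos hmu_pos h_anti (s := s) hFr n
    refine h_memLp.of_le (h_sgn.aestronglyMeasurable.mul h_memLp.ofReal.1) (.of_forall fun x => ?_)
    rw [norm_mul, Complex.norm_real]
    exact mul_le_of_le_one_left (norm_nonneg _) (norm_sgn_le_one _)
  have h_kernel (n : ℕ) : MemLp (fun x =>
      ((kernelAmplitude ‖F x‖ (weights lam r x) (weights mu s x) n : ℝ) : ℂ)) 2 volume :=
    (memLp_kernelAmplitude hlam_pos hmu_pos h_anti hFs n).ofReal
  exact ⟨fun n => (h_image n).toLp, fun n => (h_kernel n).toLp,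
    fun n => (h_image n).coeFn_toLp, fun n => (h_kernel n).coeFn_toLp⟩

end Existence

namespace HasAmplitudes

variable {P Q : ℕ → L2C} (h : HasAmplitudes F r s lam mu P Q)
include h

lemma image_sub (n : ℕ) : ∀ᵐ x, (P (n + 1) - P n) x = sgn (F x) *
    (imageAmplitude ‖F x‖ (weights lam r x) (weights mu s x) (n + 1)
      - imageAmplitude ‖F x‖ (weights lam r x) (weights mu s x) n : ℝ) := by
  filter_upwards [h.image n, h.image (n + 1), Lp.coeFn_sub (P (n + 1)) (P n)]
    with x h_old h_new h_sub
  rw [h_sub, Pi.sub_apply, h_old, h_new, Complex.ofReal_sub, mul_sub]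

lemma kernel_sub (n : ℕ) : ∀ᵐ x, (Q (n + 1) - Q n) x =
    (kernelAmplitude ‖F x‖ (weights lam r x) (weights mu s x) (n + 1)
      - kernelAmplitude ‖F x‖ (weights lam r x) (weights mu s x) n : ℝ) := by
  filter_upwards [h.kernel n, h.kernel (n + 1), Lp.coeFn_sub (Q (n + 1)) (Q n)]
    with x h_old h_new h_sub
  rw [h_sub, Pi.sub_apply, h_old, h_new, Complex.ofReal_sub]

lemma isHermitian_image_sub (hF : IsHermitian F) (n : ℕ) : IsHermitian (P (n + 1) - P n) :=
  isHermitian_of_sgn_mul hF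
    (hF.norm_comp_neg.mono fun x hx => by rw [hx, weights_neg, weights_neg]) (h.image_sub n)

lemma kernel_sub_comp_neg (hF : IsHermitian F) (n : ℕ) :
    ∀ᵐ x, (Q (n + 1) - Q n) x = (Q (n + 1) - Q n) (-x) := by
  filter_upwards [h.kernel_sub n, ae_comp_neg (h.kernel_sub n), hF.norm_comp_neg]
    with x h_pos h_neg h_norm
  rw [h_pos, h_neg, h_norm, weights_neg, weights_neg]

include hlam_pos hmu_pos
variable (h_anti : Antitone fun n => lam n * mu n)
include h_anti

lemma isPointwiseMin : IsPointwiseMin F r s lam mu P Q := fun n => by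
  filter_upwards [h.image n, h.kernel n, h.image_sub n, h.kernel_sub n]
    with x h_image h_kernel h_image_sub h_kernel_sub
  have ha := weights_pos hlam_pos r x
  have hb := weights_pos hmu_pos s x
  have hab := antitone_weights_mul_weights h_anti r s x
  rw [h_image, h_kernel, h_image_sub, h_kernel_sub]
  refine (isPointMin_amplitudes_sub (norm_nonneg _) ha hb hab n).sgn_mul (ha _).le (hb _).le
    fun hFx => ?_
  rw [(amplitudes_sub_eq_zero (norm_nonneg _) ha hb hab ?_).2, Complex.ofReal_zero]
  simpa [hFx] using (mul_pos (ha (n + 1)) (hb (n + 1))).le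

lemma isNonneg_kernel_sub (n : ℕ) : IsNonneg (Q (n + 1) - Q n) :=
  isNonneg_of_real (fun x => sub_nonneg.2 <| kernelAmplitude_le_succ (norm_nonneg _)
    (weights_pos hlam_pos r x) (weights_pos hmu_pos s x)
    (antitone_weights_mul_weights h_anti r s x) n) (h.kernel_sub n)

lemma sgn_image_sub (n : ℕ) : ∀ᵐ x,
    (lam (n + 1) * mu (n + 1) * Δ x ^ (r + s) < ‖F x‖ ^ 2 →
      sgn ((P (n + 1) - P n) x) = sgn (F x)) ∧
    (‖F x‖ ^ 2 ≤ lam (n + 1) * mu (n + 1) * Δ x ^ (r + s) → (P (n + 1) - P n) x = 0) := by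
  filter_upwards [h.image_sub n] with x h_image_sub
  have ha := weights_pos hlam_pos r x
  have hb := weights_pos hmu_pos s x
  have hab := antitone_weights_mul_weights h_anti r s x
  rw [h_image_sub, ← weights_mul_weights]
  constructor <;> intro h_threshold
  · exact sgn_sgn_mul_ofReal _ <| sub_pos.2 <|
      imageAmplitude_lt_succ (norm_nonneg _) ha hb hab h_threshold
  · rw [(amplitudes_sub_eq_zero (norm_nonneg _) ha hb hab h_threshold).1, Complex.ofReal_zero,
      mul_zero]

lemma isFourierRecipe (hF : IsHermitian F) : IsFourierRecipe F r s lam mu P Q where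
  init_image := by
    simp only [← initAmplitude_weights]
    exact h.image 0
  init_kernel := by
    simp only [← initAmplitude_weights]
    exact h.kernel 0
  step_min n := isFourierStepMin_of_isPointMin (hlam_pos _).le (hmu_pos _).le
    (h.isPointwiseMin hlam_pos hmu_pos h_anti n)
  kernel_nonneg := h.isNonneg_kernel_sub hlam_pos hmu_pos h_anti
  kernel_symm := h.kernel_sub_comp_neg hF
  image_symm := h.isHermitian_image_sub hF
  image_sgn := h.sgn_image_sub hlam_pos hmu_pos h_anti

end HasAmplitudes

end Construction

end BlindMHDM

end

theorem mainTheorem4_general (f : BlindMHDM.L2R) (r s : ℝ)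
    (hfr : BlindMHDM.sobolevSq (-r) f ≠ ∞) (hfs : BlindMHDM.sobolevSq (-s) f ≠ ∞)
    (lam mu : ℕ → ℝ) (hlam_pos : ∀ n, 0 < lam n) (hmu_pos : ∀ n, 0 < mu n)
    (h_anti : Antitone fun n => lam n * mu n) :
    (∃ U K : ℕ → BlindMHDM.L2R,
      BlindMHDM.IsMHDM f r s lam mu U K ∧
      (∀ n, BlindMHDM.IsNonneg (BlindMHDM.hat (K n))) ∧
      BlindMHDM.IsFourierRecipe (BlindMHDM.hat f) r s lam mu
        (fun n => BlindMHDM.hat (U n)) (fun n => BlindMHDM.hat (K n)) ∧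
      BlindMHDM.IsPointwiseMin (BlindMHDM.hat f) r s lam mu
        (fun n => BlindMHDM.hat (U n)) (fun n => BlindMHDM.hat (K n))) ∧
    (∀ P Q : ℕ → BlindMHDM.L2C,
      BlindMHDM.IsFourierRecipe (BlindMHDM.hat f) r s lam mu P Q →
      ∃ U K : ℕ → BlindMHDM.L2R,
        (∀ n, BlindMHDM.hat (U n) = P n ∧ BlindMHDM.hat (K n) = Q n) ∧
        BlindMHDM.IsMHDM f r s lam mu U K ∧
        (∀ n, BlindMHDM.IsNonneg (BlindMHDM.hat (K n)))) := by
  have h_converse (P Q : ℕ → BlindMHDM.L2C)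
      (h : BlindMHDM.IsFourierRecipe (BlindMHDM.hat f) r s lam mu P Q) :=
    h.exists_isMHDM hlam_pos hmu_pos
  refine ⟨?_, h_converse⟩
  obtain ⟨P, Q, h_ampl⟩ := BlindMHDM.exists_hasAmplitudes hlam_pos hmu_pos h_anti hfr hfs
  have h_recipe := h_ampl.isFourierRecipe hlam_pos hmu_pos h_anti (BlindMHDM.isHermitian_hat f)
  have h_min := h_ampl.isPointwiseMin hlam_pos hmu_pos h_anti
  obtain ⟨U, K, h_hat, h_MHDM, h_nonneg⟩ := h_converse P Q h_recipe
  obtain rfl : (fun n => BlindMHDM.hat (U n)) = P := funext fun n => (h_hat n).1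
  obtain rfl : (fun n => BlindMHDM.hat (K n)) = Q := funext fun n => (h_hat n).2
  exact ⟨U, K, h_MHDM, h_nonneg, h_recipe, h_min⟩

theorem mainTheorem4 (f : BlindMHDM.L2R) (hf : BlindMHDM.IsBandLimited f)
    (r s : ℝ) (hr : 0 ≤ r) (hs : 0 ≤ s)
    (lam mu : ℕ → ℝ) (hlam_pos : ∀ n, 0 < lam n) (hmu_pos : ∀ n, 0 < mu n)
    (hlam : Antitone lam) (hmu : Antitone mu) :
    (∃ U K : ℕ → BlindMHDM.L2R,
      BlindMHDM.IsMHDM f r s lam mu U K ∧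
      (∀ n, BlindMHDM.IsNonneg (BlindMHDM.hat (K n))) ∧
      BlindMHDM.IsFourierRecipe (BlindMHDM.hat f) r s lam mu
        (fun n => BlindMHDM.hat (U n)) (fun n => BlindMHDM.hat (K n)) ∧
      BlindMHDM.IsPointwiseMin (BlindMHDM.hat f) r s lam mu
        (fun n => BlindMHDM.hat (U n)) (fun n => BlindMHDM.hat (K n))) ∧
    (∀ P Q : ℕ → BlindMHDM.L2C,
      BlindMHDM.IsFourierRecipe (BlindMHDM.hat f) r s lam mu P Q →
      ∃ U K : ℕ → BlindMHDM.L2R,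
        (∀ n, BlindMHDM.hat (U n) = P n ∧ BlindMHDM.hat (K n) = Q n) ∧
        BlindMHDM.IsMHDM f r s lam mu U K ∧
        (∀ n, BlindMHDM.IsNonneg (BlindMHDM.hat (K n)))) :=
  mainTheorem4_general f r s (BlindMHDM.sobolevSq_neg_ne_top f hr)
    (BlindMHDM.sobolevSq_neg_ne_top f hs) lam mu hlam_pos hmu_pos
    fun _ _ h => mul_le_mul (hlam h) (hmu h) (hmu_pos _).le (hlam_pos _).le
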